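/- Let $M$ be a smooth manifold of dimension $n$, let $0<T\le\infty$, and let $g(t)$, $t\in[0,T)$, be a smooth solution of the Ricci flow $\frac{\partial}{\partial t}g_{ij}=-2R_{ij}$ on $M$ (smooth up to $t=0$). Repeated indices are summed; repeated lower indices are contracted with the metric. The curvature of a connection with Christoffel symbols $\Gamma_{ij}^k$ is $$R_{ijk}^l=\partial_i\Gamma_{jk}^l-\partial_j\Gamma_{ik}^l+\Gamma_{jk}^m\Gamma_{im}^l-\Gamma_{ik}^m\Gamma_{jm}^l ,$$ and for the Levi-Civita connection of a metric $g$ we put $R_{ijkl}=g_{lm}R_{ijk}^m$, $R_{jk}=R_{pjk}^p$, $R=g^{ij}R_{ij}$. For a metric $g$, a 2-form $U$ and a 1-form $W$, Hamilton's Harnack quantity is $$Z(U,W)=M_{ij}W_iW_j-2P_{ijk}U_{ij}W_k+R_{ijkl}U_{ij}U_{lk},$$ where $P_{ijk}=\nabla_iR_{jk}-\nabla_jR_{ik}$ and $M_{ij}=\Delta R_{ij}-\frac12\nabla_i\nabla_jR+2R_{kijl}R_{kl}-R_{ik}R_{kj}$. Let $\tau\in[0,T)$ and $\tilde M_\tau=M\times[0,T-\tau)$.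 In local coordinates $x^1,\dots,x^n$ on $M$ and $x^0=t$, let $\tilde g_\tau$ be the degenerate metric on $T^*\tilde M_\tau$ with $\tilde g^{ij}(x,t)=g^{ij}(x,t+\tau)$ for $1\le i,j\le n$ and $\tilde g^{ij}=0$ if $i=0$ or $j=0$, and let $\tilde\nabla_\tau$ be the connection on $T\tilde M_\tau$ with $$\tilde\Gamma_{ij}^k(x,t)=\Gamma_{ij}^k(x,t+\tau)\quad(1\le i,j,k\le n),\qquad \tilde\Gamma_{ij}^0(x,t)=0\quad(0\le i,j\le n),$$ $$\tilde\Gamma_{i0}^k(x,t)=\tilde\Gamma_{0i}^k(x,t)=-R_i^k(x,t+\tau),\qquad \tilde\Gamma_{00}^k(x,t)=-\tfrac12\nabla^kR(x,t+\tau)\quad(1\le i,k\le n).$$ Let $\tilde R_{ijk}^l$ be its curvature (time derivatives at $t=0$ are one-sided) and $\tilde R_{jk}^{il}=\tilde g^{ip}\tilde R_{pjk}^l$. Identify 2-forms on $\tilde M_\tau$ at $(x,t)$ with $\Lambda^2T_x^*M\oplus T_x^*M$ by $U\oplus W\leftrightarrow U+W\wedge dt$. Associate to such a form $\alpha=U\oplus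 W$ the mixed tensor $S(\alpha)$ with $S_i^j=g^{jk}(x,t+\tau)U_{ik}$ and $S_i^0=W_i$ for $1\le i,j\le n$, and $S_0^j=0$ for $0\le j\le n$. The curvature operator is the bilinear form $$\widetilde{Rm}(\alpha,\beta)=\sum_{i,j,k,l=0}^n\tilde R_{jk}^{il}\,S(\alpha)_i^j\,S(\beta)_l^k .$$ Then, in every local coordinate system on $M$ and at every $(x,t)\in\tilde M_\tau$, the bilinear form $\widetilde{Rm}$ is symmetric, and for all $U\in\Lambda^2T_x^*M$ and $W\in T_x^*M$ $$\widetilde{Rm}(U\oplus W,U\oplus W)=Z(U,W),$$ where the left side is taken at $(x,t)$ and the right side is that of the metric $g(t+\tau)$ at $x$. -/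

import Mathlib

open scoped Manifold ContDiff

noncomputable section

namespace HarnackFlow

/-- The model space `ℝⁿ`; its points are the coordinates `(x¹, …, xⁿ)`. -/
abbrev Model (n : ℕ) : Type := EuclideanSpace ℝ (Fin n)

/-! ### Curvature of a connection, in coordinates -/

/-- The curvature `R_{ijk}^l = ∂_i Γ_{jk}^l - ∂_j Γ_{ik}^l + Γ_{jk}^m Γ_{im}^l - Γ_{ik}^m Γ_{jm}^l`
of the connection with Christoffel symbols `Γ i j k = Γ_{ij}^k`.  Here `ι` is the set of coordinate
indices, `X` the coordinate domain, and `D i` the partial derivative in the direction `i`. -/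
def curvature {ι X : Type*} [Fintype ι] (D : ι → (X → ℝ) → X → ℝ) (Γ : ι → ι → ι → X → ℝ)
    (i j k l : ι) (p : X) : ℝ :=
  D i (Γ j k l) p - D j (Γ i k l) p
    + ∑ m, (Γ j k m p * Γ i m l p - Γ i k m p * Γ j m l p)

/-! ### Riemannian geometry in coordinates

`G` is the matrix `(g_{ij})` of a Riemannian metric in a coordinate system, as a function of the
coordinates.  All tensors below are given by their components. -/

section Riemannian

variable {n : ℕ}

/-- The partial derivative `∂_i f`. -/
def pd (i : Fin n) (f : Model n → ℝ) (y : Model n) : ℝ :=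
  fderiv ℝ f y (EuclideanSpace.single i 1)

/-- The inverse metric `g^{ij}`. -/
def ginv (G : Model n → Matrix (Fin n) (Fin n) ℝ) (i j : Fin n) (y : Model n) : ℝ :=
  (G y)⁻¹ i j

/-- The Christoffel symbols `Γ_{ij}^k` of the Levi-Civita connection. -/
def christoffel (G : Model n → Matrix (Fin n) (Fin n) ℝ) (i j k : Fin n) (y : Model n) : ℝ :=
  (1 / 2) * ∑ l, ginv G k l y *
    (pd i (fun z => G z j l) y + pd j (fun z => G z i l) y - pd l (fun z => G z i j) y)

/-- The Riemann curvature tensor `R_{ijk}^l`. -/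
def riem (G : Model n → Matrix (Fin n) (Fin n) ℝ) (i j k l : Fin n) (y : Model n) : ℝ :=
  curvature pd (christoffel G) i j k l y

/-- The Riemann curvature tensor with lowered index, `R_{ijkl} = g_{lm} R_{ijk}^m`. -/
def riemLow (G : Model n → Matrix (Fin n) (Fin n) ℝ) (i j k l : Fin n) (y : Model n) : ℝ :=
  ∑ m, G y l m * riem G i j k m y

/-- The Ricci tensor `R_{jk} = R_{pjk}^p`. -/
def ricci (G : Model n → Matrix (Fin n) (Fin n) ℝ) (j k : Fin n) (y : Model n) : ℝ :=
  ∑ p, riem G p j k p y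

/-- The Ricci tensor with raised index, `R_i^k = g^{kl} R_{il}`. -/
def ricciUp (G : Model n → Matrix (Fin n) (Fin n) ℝ) (i k : Fin n) (y : Model n) : ℝ :=
  ∑ l, ginv G k l y * ricci G i l y

/-- The scalar curvature `R = g^{ij} R_{ij}`. -/
def scal (G : Model n → Matrix (Fin n) (Fin n) ℝ) (y : Model n) : ℝ :=
  ∑ i, ∑ j, ginv G i j y * ricci G i j y

/-- The gradient `∇^k R = g^{kl} ∂_l R` of the scalar curvature. -/
def gradScal (G : Model n → Matrix (Fin n) (Fin n) ℝ) (k : Fin n) (y : Model n) : ℝ :=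
  ∑ l, ginv G k l y * pd l (scal G) y

/-- The covariant derivative `∇_i A_j` of a `1`-form `A`. -/
def nabla₁ (G : Model n → Matrix (Fin n) (Fin n) ℝ) (A : Fin n → Model n → ℝ)
    (i j : Fin n) (y : Model n) : ℝ :=
  pd i (A j) y - ∑ m, christoffel G i j m y * A m y

/-- The covariant derivative `∇_i A_{jk}` of a `2`-tensor `A`. -/
def nabla₂ (G : Model n → Matrix (Fin n) (Fin n) ℝ) (A : Fin n → Fin n → Model n → ℝ)
    (i j k : Fin n) (y : Model n) : ℝ :=
  pd i (A j k) y - ∑ m, christoffel G i j m y * A m k y - ∑ m, christoffel G i k m y * A j m y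

/-- The covariant derivative `∇_i A_{jkl}` of a `3`-tensor `A`. -/
def nabla₃ (G : Model n → Matrix (Fin n) (Fin n) ℝ) (A : Fin n → Fin n → Fin n → Model n → ℝ)
    (i j k l : Fin n) (y : Model n) : ℝ :=
  pd i (A j k l) y - ∑ m, christoffel G i j m y * A m k l y
    - ∑ m, christoffel G i k m y * A j m l y - ∑ m, christoffel G i l m y * A j k m y

/-- The second covariant derivative `∇_i ∇_j R` of the scalar curvature. -/
def hessScal (G : Model n → Matrix (Fin n) (Fin n) ℝ) (i j : Fin n) (y : Model n) : ℝ :=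
  nabla₁ G (fun k => pd k (scal G)) i j y

/-- The rough Laplacian `Δ R_{ij} = g^{kl} ∇_k ∇_l R_{ij}` of the Ricci tensor. -/
def lapRicci (G : Model n → Matrix (Fin n) (Fin n) ℝ) (i j : Fin n) (y : Model n) : ℝ :=
  ∑ k, ∑ l, ginv G k l y * nabla₃ G (nabla₂ G (ricci G)) k l i j y

/-- `P_{ijk} = ∇_i R_{jk} - ∇_j R_{ik}`. -/
def tensorP (G : Model n → Matrix (Fin n) (Fin n) ℝ) (i j k : Fin n) (y : Model n) : ℝ :=
  nabla₂ G (ricci G) i j k y - nabla₂ G (ricci G) j i k y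

/-- `M_{ij} = Δ R_{ij} - ½ ∇_i ∇_j R + 2 R_{kijl} R_{kl} - R_{ik} R_{kj}`, where repeated lower
indices are contracted with the metric. -/
def tensorM (G : Model n → Matrix (Fin n) (Fin n) ℝ) (i j : Fin n) (y : Model n) : ℝ :=
  lapRicci G i j y - (1 / 2) * hessScal G i j y
    + 2 * ∑ k, ∑ l, ∑ p, ∑ q,
        ginv G k p y * ginv G l q y * riemLow G k i j l y * ricci G p q y
    - ∑ k, ∑ l, ginv G k l y * ricci G i k y * ricci G l j y

/-- Raising the index of a `1`-form: `W^i = g^{ia} W_a`. -/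
def raise₁ (G : Model n → Matrix (Fin n) (Fin n) ℝ) (y : Model n) (W : Fin n → ℝ)
    (i : Fin n) : ℝ :=
  ∑ a, ginv G i a y * W a

/-- Raising both indices of a `2`-form: `U^{ij} = g^{ia} g^{jb} U_{ab}`. -/
def raise₂ (G : Model n → Matrix (Fin n) (Fin n) ℝ) (y : Model n) (U : Fin n → Fin n → ℝ)
    (i j : Fin n) : ℝ :=
  ∑ a, ∑ b, ginv G i a y * ginv G j b y * U a b

/-- Hamilton's Harnack quantity
`Z = M_{ij} W_i W_j - 2 P_{ijk} U_{ij} W_k + R_{ijkl} U_{ij} U_{lk}` (repeated lower indices are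
contracted with the metric), in terms of the components `U_{ij}` and `W_i`. -/
def harnackCoord (G : Model n → Matrix (Fin n) (Fin n) ℝ) (y : Model n)
    (U : Fin n → Fin n → ℝ) (W : Fin n → ℝ) : ℝ :=
  (∑ i, ∑ j, tensorM G i j y * raise₁ G y W i * raise₁ G y W j)
    - 2 * (∑ i, ∑ j, ∑ k, tensorP G i j k y * raise₂ G y U i j * raise₁ G y W k)
    + ∑ i, ∑ j, ∑ k, ∑ l, riemLow G i j k l y * raise₂ G y U i j * raise₂ G y U l k

end Riemannian

/-! ### The degenerate space-time geometry in coordinates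

The index set of the space-time coordinates is `Option (Fin n)`: `none` is the time index `0`
(coordinate `x⁰ = t`) and `some i` is a space index.  A point of the coordinate domain is a pair
`(y, t)`.  `G t` is the matrix of the metric `g(t)`. -/

section SpaceTime

variable {n : ℕ}

/-- The time interval `[0, T)`, where `T` may be `∞`. -/
def timeInterval (T : EReal) : Set ℝ := {s | 0 ≤ s ∧ (s : EReal) < T}

/-- The time interval `[0, T - τ)` of the space-time `M × [0, T - τ)`. -/
def shiftedInterval (T : EReal) (τ : ℝ) : Set ℝ := {s | 0 ≤ s ∧ ((s + τ : ℝ) : EReal) < T}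

/-- The degenerate metric `g̃_τ` on the cotangent bundle of space-time: `g̃^{ij}(x, t) = g^{ij}(x, t + τ)`
for space indices, and `g̃^{ij} = 0` if `i = 0` or `j = 0`. -/
def stMetric (G : ℝ → Model n → Matrix (Fin n) (Fin n) ℝ) (τ : ℝ) :
    Option (Fin n) → Option (Fin n) → Model n × ℝ → ℝ
  | some i, some j, p => ginv (G (p.2 + τ)) i j p.1
  | none, _, _ => 0
  | some _, none, _ => 0

/-- The Christoffel symbols `Γ̃_{ab}^c` (as `stChristoffel G τ a b c`) of the connection `∇̃_τ`. -/
def stChristoffel (G : ℝ → Model n → Matrix (Fin n) (Fin n) ℝ) (τ : ℝ) :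
    Option (Fin n) → Option (Fin n) → Option (Fin n) → Model n × ℝ → ℝ
  | some i, some j, some k, p => christoffel (G (p.2 + τ)) i j k p.1
  | some i, none, some k, p => -ricciUp (G (p.2 + τ)) i k p.1
  | none, some i, some k, p => -ricciUp (G (p.2 + τ)) i k p.1
  | none, none, some k, p => -(1 / 2) * gradScal (G (p.2 + τ)) k p.1
  | _, _, none, _ => 0

/-- Partial derivatives in the space-time coordinates.  The time derivative is taken within the
time interval `J`, hence is one-sided at an end point that belongs to `J`. -/
def stPd (J : Set ℝ) : Option (Fin n) → (Model n × ℝ → ℝ) → Model n × ℝ → ℝ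
  | some i, f, p => pd i (fun z => f (z, p.2)) p.1
  | none, f, p => derivWithin (fun s => f (p.1, s)) J p.2

/-- The curvature `R̃_{abc}^d` of `∇̃_τ` on `M × [0, T - τ)`. -/
def stRiem (G : ℝ → Model n → Matrix (Fin n) (Fin n) ℝ) (T : EReal) (τ : ℝ)
    (a b c d : Option (Fin n)) (p : Model n × ℝ) : ℝ :=
  curvature (stPd (shiftedInterval T τ)) (stChristoffel G τ) a b c d p

/-- The curvature with raised index, `R̃_{jk}^{il} = g̃^{ip} R̃_{pjk}^l` (as
`stRiemUp G T τ i l j k`). -/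
def stRiemUp (G : ℝ → Model n → Matrix (Fin n) (Fin n) ℝ) (T : EReal) (τ : ℝ)
    (i l j k : Option (Fin n)) (p : Model n × ℝ) : ℝ :=
  ∑ q, stMetric G τ i q p * stRiem G T τ q j k l p

/-- The identification of a `2`-form `α` on space-time, with components `α_{ab}`, with the mixed
tensor `T_a^b dx^a ⊗ ∂_b` given by `T_i^j = g^{jk} α_{ik}`, `T_i^0 = α_{i0}` and `T_0^b = 0`. -/
def mixed (G : ℝ → Model n → Matrix (Fin n) (Fin n) ℝ) (τ : ℝ) (p : Model n × ℝ)
    (α : Option (Fin n) → Option (Fin n) → ℝ) : Option (Fin n) → Option (Fin n) → ℝ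
  | some i, some j => ∑ k, stMetric G τ (some j) (some k) p * α (some i) (some k)
  | some i, none => α (some i) none
  | none, _ => 0

/-- The curvature operator of `∇̃_τ` as a bilinear form on `2`-forms of space-time,
`R̃m(α, β) = R̃_{jk}^{il} S_i^j T_l^k`, where `S` and `T` are the mixed tensors of `α` and `β`. -/
def stCurvCoord (G : ℝ → Model n → Matrix (Fin n) (Fin n) ℝ) (T : EReal) (τ : ℝ)
    (p : Model n × ℝ) (α β : Option (Fin n) → Option (Fin n) → ℝ) : ℝ :=
  ∑ i, ∑ j, ∑ k, ∑ l,
    stRiemUp G T τ i l j k p * mixed G τ p α i j * mixed G τ p β l k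

end SpaceTime

/-! ### `2`-forms on `V × ℝ` -/

section TwoForms

variable {V : Type*} [AddCommGroup V] [Module ℝ V]

/-- The `2`-form `W ∧ dt` on `V × ℝ`, for a `1`-form `W` on `V`. -/
def wedgeDt (W : V →ₗ[ℝ] ℝ) : (V × ℝ) [⋀^Fin 2]→ₗ[ℝ] ℝ where
  toFun v := W (v 0).1 * (v 1).2 - W (v 1).1 * (v 0).2
  map_update_add' := by
    intro _ v i x y
    fin_cases i <;> simp [Function.update] <;> ring
  map_update_smul' := by
    intro _ v i c x
    fin_cases i <;> simp [Function.update] <;> ring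
  map_eq_zero_of_eq' := by
    intro v i j h hij
    fin_cases i <;> fin_cases j <;> simp_all

/-- The identification `Λ²(V ⊕ ℝ)* ≅ Λ²V* ⊕ V*`.  Its inverse sends `U ⊕ W` to `U + W ∧ dt`. -/
def splitTwoForm : ((V × ℝ) [⋀^Fin 2]→ₗ[ℝ] ℝ) ≃ₗ[ℝ] (V [⋀^Fin 2]→ₗ[ℝ] ℝ) × (V →ₗ[ℝ] ℝ) where
  toFun α := (α.compLinearMap (LinearMap.inl ℝ V ℝ),
    { toFun := fun v => α ![(v, 0), (0, 1)]
      map_add' := by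
        intro v w
        have := α.map_vecCons_add (![((0 : V), (1 : ℝ))]) (v, 0) (w, 0)
        simpa using this
      map_smul' := by
        intro c v
        have := α.map_vecCons_smul (![((0 : V), (1 : ℝ))]) c (v, 0)
        simpa using this })
  map_add' := by
    intro α β
    ext <;> simp
  map_smul' := by
    intro c α
    ext <;> simp
  invFun A := A.1.compLinearMap (LinearMap.fst ℝ V ℝ) + wedgeDt A.2
  left_inv := by
    intro α
    ext v
    have hv : v = ![v 0, v 1] := by
      ext i <;> fin_cases i <;> rfl
    have h0 : v 0 = ((v 0).1, 0) + (v 0).2 • ((0 : V), (1 : ℝ)) := by ext <;> simp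
    have h1 : v 1 = ((v 1).1, 0) + (v 1).2 • ((0 : V), (1 : ℝ)) := by ext <;> simp
    have hadd₀ : ∀ a b c : V × ℝ, α ![a + b, c] = α ![a, c] + α ![b, c] :=
      fun a b c => α.map_vecCons_add ![c] a b
    have hsmul₀ : ∀ (r : ℝ) (a c : V × ℝ), α ![r • a, c] = r * α ![a, c] :=
      fun r a c => α.map_vecCons_smul ![c] r a
    have hswap : ∀ a b : V × ℝ, α ![a, b] = -α ![b, a] := by
      intro a b
      have h := α.map_swap ![b, a] (show (0 : Fin 2) ≠ 1 by decide)
      rw [← h]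
      congr 1
      ext i <;> fin_cases i <;> simp
    have hself : ∀ a : V × ℝ, α ![a, a] = 0 := fun a =>
      α.map_eq_zero_of_eq ![a, a] (i := 0) (j := 1) rfl (by decide)
    have key : α ![v 0, v 1] = α ![((v 0).1, 0), ((v 1).1, 0)]
        + α ![((v 0).1, 0), (0, 1)] * (v 1).2 - α ![((v 1).1, 0), (0, 1)] * (v 0).2 := by
      conv_lhs => rw [h0, h1]
      rw [hadd₀, hsmul₀, hswap _ (((v 1).1, 0) + _), hadd₀, hsmul₀,
        hswap (0, 1) (((v 1).1, 0) + _), hadd₀, hsmul₀, hself,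
        hswap ((v 1).1, 0) ((v 0).1, 0), hswap (0, 1) ((v 0).1, 0)]
      ring
    conv_rhs => rw [hv, key]
    change α (fun i => ((v i).1, (0 : ℝ))) + (α ![((v 0).1, 0), (0, 1)] * (v 1).2
      - α ![((v 1).1, 0), (0, 1)] * (v 0).2) = _
    have hc' : (fun i => ((v i).1, (0 : ℝ))) = ![((v 0).1, 0), ((v 1).1, 0)] := by
      funext i
      fin_cases i <;> rfl
    rw [hc']
    ring
  right_inv := by
    rintro ⟨U, W⟩
    refine Prod.ext ?_ ?_
    · ext v
      change U (fun i => v i) + (W (v 0) * 0 - W (v 1) * 0) = U v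
      simp
    · ext v
      change U (fun i => (![(v, (0 : ℝ)), (0, 1)] i).1) + (W v * 1 - W 0 * 0) = W v
      have h : U (fun i => (![(v, (0 : ℝ)), (0, 1)] i).1) = 0 :=
        U.map_coord_zero (1 : Fin 2) rfl
      rw [h]
      simp

end TwoForms

/-! ### Ricci flow on a manifold, and the two quantities at a point -/

section OnManifold

variable {n : ℕ} {M : Type*} [TopologicalSpace M] [ChartedSpace (Model n) M]

/-- The coordinate vector `∂_i` at the point `x` of the domain of the chart `φ`. -/
def coordVec (φ : OpenPartialHomeomorph M (Model n)) (x : M) (i : Fin n) :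
    TangentSpace (𝓡 n) x :=
  mfderiv (𝓡 n) (𝓡 n) φ.symm (φ x) (EuclideanSpace.single i (1 : ℝ) : Model n)

variable [IsManifold (𝓡 n) ∞ M]

/-- Smooth Riemannian metrics on `M`. -/
abbrev Metric (n : ℕ) (M : Type*) [TopologicalSpace M] [ChartedSpace (Model n) M]
    [IsManifold (𝓡 n) ∞ M] : Type _ :=
  Bundle.ContMDiffRiemannianMetric (𝓡 n) ∞ (Model n) (fun x : M => TangentSpace (𝓡 n) x)

/-- The matrix `(g_{ij})` of the metric `g` in the chart `φ`, as a function of the coordinates. -/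
def metricCoord (g : Metric n M) (φ : OpenPartialHomeomorph M (Model n)) (y : Model n) :
    Matrix (Fin n) (Fin n) ℝ :=
  Matrix.of fun i j =>
    g.inner (φ.symm y) (coordVec φ (φ.symm y) i) (coordVec φ (φ.symm y) j)

/-- The family `g(t)`, `t ∈ [0, T)`, is a smooth solution of the Ricci flow
`∂g_{ij}/∂t = -2 R_{ij}`.  The values `g t` for other `t` play no role. -/
structure IsRicciFlow (g : ℝ → Metric n M) (T : EReal) : Prop where
  smooth : ∀ φ ∈ IsManifold.maximalAtlas (𝓡 n) ∞ M, ∀ i j,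
    ContDiffOn ℝ ∞ (fun p : Model n × ℝ => metricCoord (g p.2) φ p.1 i j)
      (φ.target ×ˢ timeInterval T)
  flow : ∀ φ ∈ IsManifold.maximalAtlas (𝓡 n) ∞ M, ∀ y ∈ φ.target, ∀ t ∈ timeInterval T, ∀ i j,
    HasDerivWithinAt (fun s => metricCoord (g s) φ y i j)
      (-2 * ricci (metricCoord (g t) φ) i j y) (timeInterval T) t

/-- The coordinate vectors of space-time at `(x, t)`: `∂/∂t` and `∂/∂xⁱ`. -/
def stCoordVec (φ : OpenPartialHomeomorph M (Model n)) (x : M) :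
    Option (Fin n) → TangentSpace (𝓡 n) x × ℝ
  | some i => (coordVec φ x i, 0)
  | none => (0, 1)

/-- The curvature operator `R̃m(α, β)` of `∇̃_τ` at the point `(x, t)` of space-time, computed in the
chart `φ`, where `α` and `β` are `2`-forms on the tangent space `T_x M ⊕ ℝ` of space-time. -/
def stCurv (g : ℝ → Metric n M) (T : EReal) (τ : ℝ) (φ : OpenPartialHomeomorph M (Model n))
    (x : M) (t : ℝ) (α β : (TangentSpace (𝓡 n) x × ℝ) [⋀^Fin 2]→ₗ[ℝ] ℝ) : ℝ :=
  stCurvCoord (fun s => metricCoord (g s) φ) T τ (φ x, t)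
    (fun a b => α ![stCoordVec φ x a, stCoordVec φ x b])
    (fun a b => β ![stCoordVec φ x a, stCoordVec φ x b])

/-- Hamilton's Harnack quantity `Z(U, W)` of the metric `g` at `x`, computed in the chart `φ`. -/
def harnack (g : Metric n M) (φ : OpenPartialHomeomorph M (Model n)) (x : M)
    (U : TangentSpace (𝓡 n) x [⋀^Fin 2]→ₗ[ℝ] ℝ) (W : TangentSpace (𝓡 n) x →ₗ[ℝ] ℝ) : ℝ :=
  harnackCoord (metricCoord g φ) (φ x)
    (fun i j => U ![coordVec φ x i, coordVec φ x j]) (fun i => W (coordVec φ x i))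

end OnManifold

end HarnackFlow

end

noncomputable section

namespace HarnackFlow

open Matrix

/-! Since `S(α)_0^j = 0`, only the components `R̃_{pjk}^l` with `p` and `l` spatial contribute, and
they fall into four blocks according to whether `j` and `k` are spatial or `0`. If both are spatial,
the block is the Riemann tensor of `g`. If only `k = 0`, the coefficients `Γ̃_{i0}^k = -R_i^k` form
a tensor whose antisymmetrised covariant derivative is `-P` (`curv_space_space_time`). If only `j =
0`, the evolution of the Christoffel symbols turns `-∇_p R_k^l - ∂_t Γ_{pk}^l` into `P`
(`curv_space_time_space`). If both are `0`, the component is `∂_t R_p^l - ½ ∇_p ∇^l R - R_p^m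
R_m^l`, which the evolution of the Ricci tensor `D_Ric` identifies with `M`
(`curv_space_time_time`).

Contracting with the forms gives one `M` sum, two `P` sums and one curvature sum (`stCurvCoord_eq`).
Exchanging the forms swaps the two `P` sums and preserves the others because `M` is symmetric and
`R_{ijkl} = R_{lkji}`. On the diagonal the `P` sums coincide, which produces the factor 2 in `Z`.

The tensor calculus uses only the Leibniz rule, commuting derivations and a symmetric invertible
matrix, so it is carried out over an abstract commutative ring (`MetricAlg`), with time as one
further derivation `D`. The analysis is confined to realising this ring as the functions smooth
within `Ω × [0, T)` (`smoothFun`). Evaluation at a point is an algebra map carrying the abstract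
tensors to the coordinate ones (the `ev_` lemmas of `CoordFlow`). -/

/-! ### Entrywise derivations of matrices. -/

theorem map_derivation_mul {ι K : Type*} [Fintype ι] [CommRing K] [Algebra ℝ K]
    (D : Derivation ℝ K K) (X Y : Matrix ι ι K) :
    (X * Y).map D = X.map D * Y + X * Y.map D := by
  ext i j
  simp only [Matrix.map_apply, Matrix.mul_apply, Matrix.add_apply, map_sum, Derivation.leibniz,
    smul_eq_mul, ← Finset.sum_add_distrib]
  exact Finset.sum_congr rfl fun _ _ => by ring

theorem map_derivation_add {ι K : Type*} [CommRing K] [Algebra ℝ K]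
    (D : Derivation ℝ K K) (X Y : Matrix ι ι K) : (X + Y).map D = X.map D + Y.map D := by
  ext i j; simp

theorem map_derivation_sub {ι K : Type*} [CommRing K] [Algebra ℝ K]
    (D : Derivation ℝ K K) (X Y : Matrix ι ι K) : (X - Y).map D = X.map D - Y.map D := by
  ext i j; simp

theorem map_derivation_one {ι K : Type*} [DecidableEq ι] [CommRing K] [Algebra ℝ K]
    (D : Derivation ℝ K K) : (1 : Matrix ι ι K).map D = 0 := by
  ext i j; by_cases h : i = j <;> simp [h]

/-- The ring may have zero divisors, but 2 is invertible because of the real scalars. -/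
theorem eq_of_two_mul_eq {K : Type*} [CommRing K] [Algebra ℝ K] {a b : K} (h : 2 * a = 2 * b) :
    a = b := by
  have h2 : ∀ x : K, (1 / 2 : ℝ) • (2 * x) = x := fun x => by
    rw [two_mul, ← two_smul ℝ x, smul_smul]; norm_num
  rw [← h2 a, h, h2]

theorem sum_pair_comm {ι K : Type*} [Fintype ι] [AddCommMonoid K] (F : ι → ι → ι → ι → K) :
    ∑ i, ∑ j, ∑ k, ∑ l, F i j k l = ∑ k, ∑ l, ∑ i, ∑ j, F i j k l := by
  have h : ∀ i, ∑ j, ∑ k, ∑ l, F i j k l = ∑ k, ∑ l, ∑ j, F i j k l := fun i =>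
    Finset.sum_comm.trans (Finset.sum_congr rfl fun k _ => Finset.sum_comm)
  simp only [h]
  exact Finset.sum_comm.trans (Finset.sum_congr rfl fun k _ => Finset.sum_comm)

/-! ### The Levi-Civita connection and the symmetries of its curvature. -/

/-- A symmetric matrix `g` with inverse `gi` over a commutative ring with commuting derivations
`d i`: the algebraic data from which the curvature tensors of a metric are computed. -/
structure MetricAlg (ι K : Type*) [Fintype ι] [DecidableEq ι] [CommRing K] [Algebra ℝ K] where
  d : ι → Derivation ℝ K K
  d_comm : ∀ i j f, d i (d j f) = d j (d i f)
  g : Matrix ι ι K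
  gi : Matrix ι ι K
  g_symm : gᵀ = g
  gi_mul : gi * g = 1

namespace MetricAlg

variable {ι K : Type*} [Fintype ι] [DecidableEq ι] [CommRing K] [Algebra ℝ K]
  (A : MetricAlg ι K)

theorem mul_gi : A.g * A.gi = 1 := mul_eq_one_comm.mp A.gi_mul

theorem gi_symm : A.giᵀ = A.gi := by
  have h : A.giᵀ * A.g = 1 := by
    rw [← transpose_one, ← A.mul_gi, transpose_mul, A.g_symm]
  calc A.giᵀ = A.giᵀ * (A.g * A.gi) := by rw [A.mul_gi, mul_one]
    _ = A.gi := by rw [← mul_assoc, h, one_mul]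

theorem g_apply_symm (i j : ι) : A.g i j = A.g j i := congrFun (congrFun A.g_symm j) i

theorem gi_apply_symm (i j : ι) : A.gi i j = A.gi j i := congrFun (congrFun A.gi_symm j) i

/-- The Christoffel symbols: `chr i l k = Γ_{ik}^l`. -/
def chr (i : ι) : Matrix ι ι K := Matrix.of fun l k =>
  (1 / 2 : ℝ) • ∑ m, A.gi l m * (A.d i (A.g k m) + A.d k (A.g i m) - A.d m (A.g i k))

theorem chr_symm (i l k : ι) : A.chr i l k = A.chr k l i := by
  simp only [chr, of_apply, A.g_apply_symm i k]
  congr 1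
  exact Finset.sum_congr rfl fun _ _ => by ring

theorem g_mul_chr (i l k : ι) : (A.g * A.chr i) l k =
    (1 / 2 : ℝ) • (A.d i (A.g k l) + A.d k (A.g i l) - A.d l (A.g i k)) := by
  have h : A.g *ᵥ (A.gi *ᵥ fun m => A.d i (A.g k m) + A.d k (A.g i m) - A.d m (A.g i k)) =
      fun m => A.d i (A.g k m) + A.d k (A.g i m) - A.d m (A.g i k) := by
    rw [mulVec_mulVec, A.mul_gi, one_mulVec]
  simpa [mul_apply, chr, mulVec, dotProduct, ← Finset.smul_sum] using
    congrArg (fun x => (1 / 2 : ℝ) • x) (congrFun h l)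

/-- This is `∇g = 0` in matrix form. In the lowered Christoffel symbol plus its transpose, only the
derivative in direction `i` survives. -/
theorem compat (i : ι) : A.g.map (A.d i) = (A.chr i)ᵀ * A.g + A.g * A.chr i := by
  have h : (A.chr i)ᵀ * A.g = (A.g * A.chr i)ᵀ := by rw [transpose_mul, A.g_symm]
  ext l k
  rw [h, Matrix.add_apply, transpose_apply, g_mul_chr, g_mul_chr, map_apply, ← smul_add,
    A.g_apply_symm l k]
  have : A.d i (A.g k l) + A.d l (A.g i k) - A.d k (A.g i l)
      + (A.d i (A.g k l) + A.d k (A.g i l) - A.d l (A.g i k)) = (2 : ℝ) • A.d i (A.g k l) := by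
    rw [two_smul]; ring
  rw [this, smul_smul]
  norm_num

/-- The endomorphisms `R_{ij}`: `Rm i j l k = R_{ijk}^l`. -/
def Rm (i j : ι) : Matrix ι ι K :=
  (A.chr j).map (A.d i) - (A.chr i).map (A.d j) + (A.chr i * A.chr j - A.chr j * A.chr i)

/-- The lowered curvature tensor: `RL i j l k = R_{ijkl}`. -/
def RL (i j : ι) : Matrix ι ι K := A.g * A.Rm i j

theorem Rm_antisymm (i j : ι) : A.Rm i j = -A.Rm j i := by simp only [Rm]; abel

theorem RL_antisymm (i j : ι) : A.RL i j = -A.RL j i := by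
  rw [RL, A.Rm_antisymm, RL, mul_neg]

theorem gi_mul_RL (i j : ι) : A.gi * A.RL i j = A.Rm i j := by
  rw [RL, ← mul_assoc, A.gi_mul, one_mul]

theorem map_d_comm (i j : ι) (X : Matrix ι ι K) :
    (X.map (A.d i)).map (A.d j) = (X.map (A.d j)).map (A.d i) := by
  ext a b; simp [A.d_comm i j]

/-- The covariant derivative of a matrix of type `(0, 2)` in the direction `i`. -/
def nab (i : ι) (B : Matrix ι ι K) : Matrix ι ι K :=
  B.map (A.d i) - (A.chr i)ᵀ * B - B * A.chr i

/-- The Ricci identity. The direction `j` is a mere label in `nab j B` and receives no Christoffel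
correction, so no symmetry of the connection is needed. -/
theorem nab_comm (i j : ι) (B : Matrix ι ι K) :
    A.nab i (A.nab j B) - A.nab j (A.nab i B) = -((A.Rm i j)ᵀ * B) - B * A.Rm i j := by
  simp only [nab, Rm, map_derivation_mul, map_derivation_sub, transpose_add, transpose_sub,
    transpose_mul, transpose_map, A.map_d_comm j i]
  noncomm_ring

theorem nab_g (i : ι) : A.nab i A.g = 0 := by rw [nab, A.compat]; abel

/-- The Ricci identity applied to the parallel tensor `g`. -/
theorem RL_skew (i j : ι) : (A.RL i j)ᵀ = -A.RL i j := by
  have h := A.nab_comm i j A.g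
  have h0 : ∀ k, A.nab k 0 = 0 := fun k => by ext; simp [nab]
  rw [A.nab_g, A.nab_g, h0, h0, sub_zero] at h
  rw [RL, transpose_mul, A.g_symm]
  have h' := congrArg (fun X => X + (A.Rm i j)ᵀ * A.g) h
  simp only [zero_add] at h'
  rw [h']; abel

/-- The first Bianchi identity: once the lower indices of the Christoffel symbols are put in a
common order, the terms cancel in pairs. -/
theorem Rm_bianchi (i j k l : ι) : A.Rm i j l k + A.Rm j k l i + A.Rm k i l j = 0 := by
  simp only [Rm, Matrix.add_apply, Matrix.sub_apply, mul_apply, map_apply, A.chr_symm j _ i,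
    A.chr_symm k _ i, A.chr_symm k _ j]
  ring

theorem RL_bianchi (i j k l : ι) : A.RL i j l k + A.RL j k l i + A.RL k i l j = 0 := by
  simp only [RL, mul_apply, ← Finset.sum_add_distrib, ← mul_add, A.Rm_bianchi, mul_zero,
    Finset.sum_const_zero]

theorem RL_skew_apply (i j k l : ι) : A.RL i j l k = -A.RL i j k l := by
  rw [← Matrix.neg_apply, ← A.RL_skew, transpose_apply]

theorem RL_antisymm_apply (i j k l : ι) : A.RL i j l k = -A.RL j i l k := by
  rw [A.RL_antisymm, Matrix.neg_apply]

/-- The pair symmetry `R_{ijkl} = R_{klij}`. -/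
theorem RL_pair (i j k l : ι) : A.RL i j l k = A.RL k l j i := by
  have h1 := A.RL_bianchi i j k l
  have h2 := A.RL_bianchi j k l i
  have h3 := A.RL_bianchi k l i j
  have h4 := A.RL_bianchi l i j k
  have e1 := A.RL_skew_apply i j k l
  have e2 := A.RL_skew_apply j k l i
  have e3 := A.RL_skew_apply k l i j
  have e4 := A.RL_skew_apply l i j k
  have e5 := A.RL_skew_apply k i l j
  have e6 := A.RL_skew_apply l j i k
  have e7 := A.RL_antisymm_apply i k l j
  have e8 := A.RL_antisymm_apply j l i k
  -- The octahedron argument: a signed sum of the four cyclic identities, each fixing a different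
  -- index. The two antisymmetries cancel everything except twice the claim.
  refine eq_of_two_mul_eq ?_
  linear_combination h1 - h4 + h2 - h3 + e1 - e2 - e3 + e4 - e5 - e6 + e7 + e8

/-! ### Contractions and the Ricci tensor. -/

/-- The contraction `g^{ij} B_{ij}`. -/
def tr (B : Matrix ι ι K) : K := ∑ i, ∑ j, A.gi i j * B i j

theorem tr_eq_trace (B : Matrix ι ι K) : A.tr B = (A.gi * B).trace := by
  simp only [tr, trace, diag, mul_apply]
  rw [Finset.sum_comm]
  exact Finset.sum_congr rfl fun i _ => Finset.sum_congr rfl fun j _ => by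
    rw [A.gi_apply_symm]

theorem tr_add (B C : Matrix ι ι K) : A.tr (B + C) = A.tr B + A.tr C := by
  simp [tr, mul_add, Finset.sum_add_distrib]

theorem tr_sub (B C : Matrix ι ι K) : A.tr (B - C) = A.tr B - A.tr C := by
  simp [tr, mul_sub, Finset.sum_sub_distrib]

theorem tr_neg (B : Matrix ι ι K) : A.tr (-B) = -A.tr B := by
  simp [tr]

theorem tr_smul (c : K) (B : Matrix ι ι K) : A.tr (c • B) = c * A.tr B := by
  simp [tr, Finset.mul_sum, mul_left_comm]

theorem tr_sum {κ : Type*} (s : Finset κ) (B : κ → Matrix ι ι K) :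
    A.tr (∑ a ∈ s, B a) = ∑ a ∈ s, A.tr (B a) := by
  simp only [tr_eq_trace, Matrix.mul_sum, Matrix.trace_sum]

theorem tr_transpose (B : Matrix ι ι K) : A.tr Bᵀ = A.tr B := by
  rw [tr, Finset.sum_comm, tr]
  exact Finset.sum_congr rfl fun i _ => Finset.sum_congr rfl fun j _ => by
    rw [A.gi_apply_symm, transpose_apply]

theorem map_gi (D : Derivation ℝ K K) : A.gi.map D = -(A.gi * A.g.map D * A.gi) := by
  have h := map_derivation_mul D A.gi A.g
  rw [A.gi_mul, map_derivation_one] at h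
  have h2 : A.gi.map D * A.g = -(A.gi * A.g.map D) := (neg_eq_of_add_eq_zero_left h.symm).symm
  calc A.gi.map D = A.gi.map D * A.g * A.gi := by rw [mul_assoc, A.mul_gi, mul_one]
    _ = _ := by rw [h2, neg_mul]

theorem map_d_gi (i : ι) :
    A.gi.map (A.d i) = -(A.gi * (A.chr i)ᵀ) - A.chr i * A.gi := by
  have h : A.gi * (A.g * A.chr i) * A.gi = A.chr i * A.gi := by
    rw [← mul_assoc A.gi, A.gi_mul, one_mul]
  rw [A.map_gi, A.compat, mul_add, add_mul, h, mul_assoc, mul_assoc, A.mul_gi, mul_one]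
  abel

/-- The inverse metric is parallel (`map_d_gi`), and cyclicity of the trace matches the remaining
Christoffel terms. -/
theorem d_tr (k : ι) (B : Matrix ι ι K) : A.d k (A.tr B) = A.tr (A.nab k B) := by
  have h : A.d k (A.tr B) = ((A.gi * B).map (A.d k)).trace := by
    simp [tr_eq_trace, trace]
  rw [h, map_derivation_mul, A.map_d_gi, tr_eq_trace, nab]
  have h2 : (A.chr k * (A.gi * B)).trace = (A.gi * (B * A.chr k)).trace := by
    rw [trace_mul_comm, mul_assoc]
  simp only [sub_mul, mul_sub, neg_mul, trace_add, trace_sub, trace_neg, h2, mul_assoc]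
  ring

theorem nab_apply (i j k : ι) (B : Matrix ι ι K) : A.nab i B j k =
    A.d i (B j k) - ∑ m, A.chr i m j * B m k - ∑ m, A.chr i m k * B j m := by
  simp only [nab, Matrix.sub_apply, mul_apply, map_apply, transpose_apply, mul_comm (B j _)]

/-- The Ricci tensor. -/
def Ric : Matrix ι ι K := Matrix.of fun j k => ∑ p, A.Rm p j p k

theorem tr_RL (j k : ι) : A.tr (Matrix.of fun p q => A.RL p j q k) = A.Ric j k := by
  simp only [tr, Ric, of_apply, ← A.gi_mul_RL, mul_apply]

theorem Ric_symm : A.Ricᵀ = A.Ric := by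
  ext j k
  rw [transpose_apply, ← tr_RL, ← tr_RL, ← tr_transpose]
  congr 1
  ext p q
  simp only [transpose_apply, of_apply]
  rw [A.RL_pair, A.RL_antisymm_apply, A.RL_skew_apply, neg_neg]

theorem Ric_apply_symm (i j : ι) : A.Ric i j = A.Ric j i :=
  congrFun (congrFun A.Ric_symm j) i

/-- The scalar curvature. -/
def scalar : K := A.tr A.Ric

/-! ### The second Bianchi identity and its contractions. -/

/-- The covariant derivative `∇_i R_{jklm}` of the curvature tensor. -/
def nabRL (i j k l m : ι) : K :=
  A.nab i (A.RL j k) m l - ∑ a, A.chr i a j * A.RL a k m l - ∑ a, A.chr i a k * A.RL j a m l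

theorem nab_neg (i : ι) (B : Matrix ι ι K) : A.nab i (-B) = -A.nab i B := by
  have : (-B).map (A.d i) = -B.map (A.d i) := by ext; simp
  rw [nab, nab, this]
  noncomm_ring

theorem nab_transpose (i : ι) (B : Matrix ι ι K) : A.nab i Bᵀ = (A.nab i B)ᵀ := by
  simp only [nab, transpose_sub, transpose_mul, transpose_transpose, transpose_map]
  abel

/-- Because `g` is parallel, lowering an index commutes with covariant differentiation; the bracket
is the covariant derivative of an endomorphism. -/
theorem nab_mul_g (i : ι) (X : Matrix ι ι K) :
    A.nab i (A.g * X) = A.g * (X.map (A.d i) + A.chr i * X - X * A.chr i) := by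
  rw [nab, map_derivation_mul, A.compat]
  noncomm_ring

theorem nabRL_antisymm (i j k l m : ι) : A.nabRL i j k l m = -A.nabRL i k j l m := by
  simp only [nabRL]
  rw [A.RL_antisymm j k, nab_neg]
  simp only [A.RL_antisymm _ k, A.RL_antisymm j _, Matrix.neg_apply, mul_neg,
    Finset.sum_neg_distrib]
  ring

theorem nabRL_skew (i j k l m : ι) : A.nabRL i j k l m = -A.nabRL i j k m l := by
  simp only [nabRL]
  have h : A.nab i (A.RL j k) m l = -A.nab i (A.RL j k) l m := by
    rw [← Matrix.neg_apply, ← nab_neg, ← RL_skew, nab_transpose, transpose_apply]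
  rw [h]
  simp only [A.RL_skew_apply _ _ l m, mul_neg, Finset.sum_neg_distrib]
  ring

/-- The second Bianchi identity. -/
theorem nabRL_bianchi (i j k l m : ι) :
    A.nabRL i j k l m + A.nabRL j k i l m + A.nabRL k i j l m = 0 := by
  -- Here only the matrix indices are differentiated covariantly, and the identity is the Jacobi
  -- identity for the operators `∂_i + Γ_i`. The corrections for the direction indices cancel
  -- afterwards, since the connection is torsion-free and the curvature antisymmetric.
  have h : A.nab i (A.RL j k) + A.nab j (A.RL k i) + A.nab k (A.RL i j) = 0 := by
    simp only [RL, nab_mul_g, ← mul_add]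
    convert mul_zero A.g
    simp only [Rm, map_derivation_mul, map_derivation_sub, map_derivation_add,
      A.map_d_comm j i, A.map_d_comm k i, A.map_d_comm k j]
    noncomm_ring
  have h' := congrFun (congrFun h m) l
  simp only [Matrix.add_apply, Matrix.zero_apply] at h'
  simp only [nabRL, A.chr_symm j _ i, A.chr_symm k _ i, A.chr_symm k _ j]
  have e1 : ∀ a, A.RL a i m l = -A.RL i a m l := fun a => A.RL_antisymm_apply _ _ _ _
  have e2 : ∀ a, A.RL a j m l = -A.RL j a m l := fun a => A.RL_antisymm_apply _ _ _ _
  have e3 : ∀ a, A.RL a k m l = -A.RL k a m l := fun a => A.RL_antisymm_apply _ _ _ _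
  simp only [e1, e2, e3, mul_neg, Finset.sum_neg_distrib]
  linear_combination h'

/-- Contraction over the first and last index commutes with the covariant derivative. -/
theorem tr_nabRL (i k l : ι) :
    A.tr (Matrix.of fun j m => A.nabRL i j k l m) = A.nab i A.Ric k l := by
  have h : (Matrix.of fun j m => A.nabRL i j k l m) =
      A.nab i (Matrix.of fun p q => A.RL p k q l)
      - ∑ a, A.chr i a k • (Matrix.of fun p q => A.RL p a q l)
      - ∑ a, A.chr i a l • (Matrix.of fun p q => A.RL p k q a) := by
    ext j m
    simp only [of_apply, nabRL, nab_apply, Matrix.sub_apply, Matrix.sum_apply, Matrix.smul_apply,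
      smul_eq_mul]
    ring
  rw [h, tr_sub, tr_sub, tr_sum, tr_sum, ← d_tr, nab_apply]
  simp only [tr_smul, tr_RL]

/-- The contracted second Bianchi identity `g^{im} ∇_i R_{jm} = ½ ∂_j R`. -/
theorem div_Ric (j : ι) :
    2 * A.tr (Matrix.of fun i m => A.nab i A.Ric j m) = A.d j A.scalar := by
  -- In the double trace of the second Bianchi identity, the first and third terms each give the
  -- divergence of the Ricci tensor and the middle one gives `-∂_j R`.
  have hB : ∑ i, ∑ m, ∑ k, ∑ l, A.gi i m * A.gi k l *
      (A.nabRL i j k l m + A.nabRL j k i l m + A.nabRL k i j l m) = 0 := by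
    simp [nabRL_bianchi]
  have h1 : ∑ i, ∑ m, ∑ k, ∑ l, A.gi i m * A.gi k l * A.nabRL i j k l m =
      A.tr (Matrix.of fun i m => A.nab i A.Ric j m) := by
    simp only [tr, of_apply, ← tr_nabRL, Finset.mul_sum, mul_assoc]
    refine Finset.sum_congr rfl fun i _ => Finset.sum_congr rfl fun m _ =>
      Finset.sum_congr rfl fun k _ => Finset.sum_congr rfl fun l _ => ?_
    rw [A.nabRL_antisymm, A.nabRL_skew, neg_neg]
  have h2 : ∑ i, ∑ m, ∑ k, ∑ l, A.gi i m * A.gi k l * A.nabRL j k i l m = -A.d j A.scalar := by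
    rw [scalar, d_tr]
    simp only [tr, ← tr_nabRL, of_apply, Finset.mul_sum, ← Finset.sum_neg_distrib]
    rw [sum_pair_comm]
    refine Finset.sum_congr rfl fun k _ => Finset.sum_congr rfl fun l _ =>
      Finset.sum_congr rfl fun i _ => Finset.sum_congr rfl fun m _ => ?_
    rw [A.nabRL_antisymm]
    ring
  have h3 : ∑ i, ∑ m, ∑ k, ∑ l, A.gi i m * A.gi k l * A.nabRL k i j l m =
      A.tr (Matrix.of fun i m => A.nab i A.Ric j m) := by
    simp only [tr, of_apply, ← tr_nabRL, Finset.mul_sum]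
    rw [sum_pair_comm]
    refine Finset.sum_congr rfl fun k _ => Finset.sum_congr rfl fun l _ =>
      Finset.sum_congr rfl fun i _ => Finset.sum_congr rfl fun m _ => ?_
    ring
  simp only [mul_add, Finset.sum_add_distrib, h1, h2, h3] at hB
  linear_combination hB

end MetricAlg

theorem mul_entry {ι K : Type*} [Fintype ι] [CommRing K] (X Y : Matrix ι ι K) (i j : ι) :
    (X * Y) i j = ∑ m, X i m * Y m j := Matrix.mul_apply

namespace MetricAlg

variable {ι K : Type*} [Fintype ι] [DecidableEq ι] [CommRing K] [Algebra ℝ K]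
  (A : MetricAlg ι K)

/-! ### Second derivatives of the Ricci tensor, and Hamilton's tensors `M` and `P`. -/

/-- The Hessian of the scalar curvature. -/
def hess : Matrix ι ι K := Matrix.of fun i j =>
  A.d i (A.d j A.scalar) - ∑ m, A.chr i m j * A.d m A.scalar

theorem hess_symm (i j : ι) : A.hess i j = A.hess j i := by
  simp only [hess, of_apply, A.d_comm i j, A.chr_symm i _ j]

/-- The covariant derivative `∇_k T_{lij}` of a tensor of type `(0, 3)`, as a matrix in `i`, `j`. -/
def cov (k : ι) (T : ι → Matrix ι ι K) (l : ι) : Matrix ι ι K :=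
  A.nab k (T l) - ∑ m, A.chr k m l • T m

theorem cov_apply (k l i j : ι) (T : ι → Matrix ι ι K) : A.cov k T l i j =
    A.d k (T l i j) - ∑ m, A.chr k m l * T m i j - ∑ m, A.chr k m i * T l m j
      - ∑ m, A.chr k m j * T l i m := by
  simp only [cov, nab_apply, Matrix.sub_apply, Matrix.sum_apply, Matrix.smul_apply, smul_eq_mul]
  ring

/-- The correction for the label index is symmetric in `p` and `j`, as the connection is
torsion-free. Hence `nab_comm` also applies to full second covariant derivatives. -/
theorem nab_sub_nab (p j : ι) (T : ι → Matrix ι ι K) :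
    A.nab p (T j) - A.nab j (T p) = A.cov p T j - A.cov j T p := by
  simp only [cov, A.chr_symm p _ j]
  abel

theorem tr_cov (k l : ι) (T : ι → Matrix ι ι K) :
    A.tr (A.cov k T l) = A.d k (A.tr (T l)) - ∑ m, A.chr k m l * A.tr (T m) := by
  simp only [cov, tr_sub, tr_sum, tr_smul, d_tr]

theorem tr_cov_outer (k i : ι) (T : ι → Matrix ι ι K) :
    A.tr (Matrix.of fun p q => A.cov k T p i q) =
      A.d k (A.tr (Matrix.of fun p q => T p i q))
        - ∑ m, A.chr k m i * A.tr (Matrix.of fun p q => T p m q) := by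
  rw [← A.tr_cov k i (fun i => Matrix.of fun p q => T p i q)]
  congr 1
  ext p q
  simp only [cov_apply, of_apply]
  ring

/-- The first covariant derivative of the Ricci tensor. -/
def nabRic (i : ι) : Matrix ι ι K := A.nab i A.Ric

theorem nabRic_symm (i j k : ι) : A.nabRic i j k = A.nabRic i k j := by
  rw [nabRic, ← transpose_apply (A.nab i A.Ric), ← nab_transpose, Ric_symm]

/-- The second covariant derivative `∇_p ∇_j R_{kq}` of the Ricci tensor. -/
def nab2Ric (p j : ι) : Matrix ι ι K := A.cov p A.nabRic j

theorem nab2Ric_symm (p j k q : ι) : A.nab2Ric p j k q = A.nab2Ric p j q k := by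
  simp only [nab2Ric, cov_apply, A.nabRic_symm _ k]
  simp only [A.nabRic_symm _ q]
  ring

/-- The rough Laplacian of the Ricci tensor. -/
def lap : Matrix ι ι K := Matrix.of fun j k => A.tr (Matrix.of fun p q => A.nab2Ric p q j k)

theorem lap_symm (j k : ι) : A.lap j k = A.lap k j := by
  simp only [lap, of_apply, A.nab2Ric_symm _ _ j k]

/-- The Ricci tensor with raised indices. -/
def RicUp2 : Matrix ι ι K := A.gi * A.Ric * A.gi

theorem RicUp2_symm (k l : ι) : A.RicUp2 k l = A.RicUp2 l k := by
  have : A.RicUp2ᵀ = A.RicUp2 := by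
    simp only [RicUp2, transpose_mul, A.gi_symm, A.Ric_symm, mul_assoc]
  rw [← transpose_apply A.RicUp2, this]

/-- The contraction `R_{kijl} R_{kl}`. -/
def RmRic : Matrix ι ι K := Matrix.of fun i j => ∑ k, ∑ l, A.RL k i l j * A.RicUp2 k l

theorem RmRic_symm (i j : ι) : A.RmRic i j = A.RmRic j i := by
  simp only [RmRic, of_apply]
  rw [Finset.sum_comm]
  refine Finset.sum_congr rfl fun l _ => Finset.sum_congr rfl fun k _ => ?_
  rw [A.RL_pair, A.RL_antisymm_apply, A.RL_skew_apply, neg_neg, A.RicUp2_symm]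

theorem Ric_gi_Ric_symm (i j : ι) : (A.Ric * A.gi * A.Ric) i j = (A.Ric * A.gi * A.Ric) j i := by
  have : (A.Ric * A.gi * A.Ric)ᵀ = A.Ric * A.gi * A.Ric := by
    simp only [transpose_mul, A.gi_symm, A.Ric_symm, mul_assoc]
  rw [← transpose_apply (A.Ric * A.gi * A.Ric), this]

theorem tr_nab2Ric_inner (j k : ι) : A.tr (A.nab2Ric j k) = A.hess j k := by
  simp only [nab2Ric, tr_cov, nabRic, ← d_tr, hess, of_apply, scalar]

/-- The inner derivative is contracted with a Ricci index, so this is the derivative of `div_Ric`.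
-/
theorem two_mul_tr_nab2Ric_outer (j k : ι) :
    2 * A.tr (Matrix.of fun p q => A.nab2Ric j p k q) = A.hess j k := by
  simp only [nab2Ric, tr_cov_outer, hess, of_apply, ← div_Ric, nabRic, mul_sub, Finset.mul_sum,
    mul_left_comm _ (2 : K)]
  congr 1
  rw [two_mul, two_mul, map_add]

theorem tr_Rm (j m : ι) :
    A.tr (Matrix.of fun p q => A.Rm p j m q) = -(A.gi * A.Ric) m j := by
  have h : (Matrix.of fun p q => A.Rm p j m q) =
      -∑ s, A.gi m s • (Matrix.of fun p q => A.RL p s q j)ᵀ := by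
    ext p q
    simp only [of_apply, ← A.gi_mul_RL, mul_apply, Matrix.neg_apply, Matrix.sum_apply,
      Matrix.smul_apply, transpose_apply, smul_eq_mul, ← Finset.sum_neg_distrib]
    refine Finset.sum_congr rfl fun s _ => ?_
    rw [A.RL_pair, A.RL_skew_apply, mul_neg]
  rw [h, tr_neg, tr_sum]
  simp only [tr_smul, tr_transpose, tr_RL, mul_apply]

/-- The contracted commutator of covariant derivatives of the Ricci tensor. -/
theorem tr_nab2Ric_comm (j k : ι) :
    A.tr (Matrix.of fun p q => A.nab2Ric p j k q) =
      A.tr (Matrix.of fun p q => A.nab2Ric j p k q) - A.RmRic j k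
        + (A.Ric * A.gi * A.Ric) j k := by
  -- The Ricci identity for the Ricci tensor. After tracing, the curvature acting on `k` gives
  -- `R_{kijl} R_{kl}`, and acting on the contracted index `q` it gives the square of the Ricci
  -- tensor.
  have h : (Matrix.of fun p q => A.nab2Ric p j k q) =
      (Matrix.of fun p q => A.nab2Ric j p k q)
      - (Matrix.of fun p q => ((A.Rm p j)ᵀ * A.Ric) k q)
      - ∑ m, A.Ric k m • (Matrix.of fun p q => A.Rm p j m q) := by
    ext p q
    have := congrFun (congrFun (A.nab_comm p j A.Ric) k) q
    have h2 := congrFun (congrFun (A.nab_sub_nab p j A.nabRic) k) q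
    simp only [Matrix.sub_apply, Matrix.neg_apply, nabRic] at this h2
    simp only [Matrix.sub_apply, of_apply, Matrix.sum_apply, Matrix.smul_apply, smul_eq_mul]
    simp only [mul_entry A.Ric] at this
    rw [h2] at this
    simp only [nab2Ric]
    linear_combination this
  have h1 : A.tr (Matrix.of fun p q => ((A.Rm p j)ᵀ * A.Ric) k q) = A.RmRic j k := by
    simp only [RmRic, tr, of_apply]
    refine Finset.sum_congr rfl fun p _ => ?_
    have e : ∀ q, ((A.Rm p j)ᵀ * A.Ric) k q = ∑ l, A.RL p j l k * (A.gi * A.Ric) l q := by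
      intro q
      rw [← A.gi_mul_RL, transpose_mul, A.gi_symm, mul_assoc, mul_apply]
      rfl
    simp only [e, Finset.mul_sum]
    rw [Finset.sum_comm]
    refine Finset.sum_congr rfl fun l _ => ?_
    rw [RicUp2_symm, RicUp2, mul_apply, Finset.mul_sum]
    refine Finset.sum_congr rfl fun q _ => ?_
    rw [A.gi_apply_symm]
    ring
  have h2 : A.tr (∑ m, A.Ric k m • (Matrix.of fun p q => A.Rm p j m q)) =
      -(A.Ric * A.gi * A.Ric) j k := by
    simp only [tr_sum, tr_smul, tr_Rm]
    rw [A.Ric_gi_Ric_symm, mul_assoc, mul_apply]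
    simp
  rw [h, tr_sub, tr_sub, h1, h2]
  ring

/-- Hamilton's tensor `M_{ij}`. -/
def M : Matrix ι ι K := Matrix.of fun i j =>
  A.lap i j - (1 / 2 : ℝ) • A.hess i j + 2 * A.RmRic i j - (A.Ric * A.gi * A.Ric) i j

theorem M_symm (i j : ι) : A.M i j = A.M j i := by
  simp only [M, of_apply, A.lap_symm i j, A.hess_symm i j, A.RmRic_symm i j,
    A.Ric_gi_Ric_symm i j]

/-- Hamilton's tensor `P_{ijk}`. -/
def P (i j k : ι) : K := A.nabRic i j k - A.nabRic j i k

/-! ### Evolution equations under the Ricci flow -/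

theorem map_D_comm {D : Derivation ℝ K K} (hD : ∀ i f, D (A.d i f) = A.d i (D f)) (i : ι)
    (X : Matrix ι ι K) : (X.map (A.d i)).map D = (X.map D).map (A.d i) := by
  ext a b; simp [hD]

/-- The evolution of the Levi-Civita connection. -/
theorem g_mul_D_chr {D : Derivation ℝ K K} (hD : ∀ i f, D (A.d i f) = A.d i (D f))
    (hflow : ∀ i j, D (A.g i j) = -2 * A.Ric i j) (i q k : ι) :
    (A.g * (A.chr i).map D) q k = A.nabRic q i k - A.nabRic i k q - A.nabRic k i q := by
  set a : ι → Matrix ι ι K := fun i => A.g * (A.chr i).map D with ha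
  have hs : ∀ i q k, a i q k = a k q i := fun i q k => by
    simp only [ha, mul_apply, map_apply, A.chr_symm i _ k]
  have hg : A.g.map D = -(A.Ric + A.Ric) := by
    ext i j
    simp only [map_apply, hflow, Matrix.neg_apply, Matrix.add_apply]
    ring
  -- The time derivative of metric compatibility: the terms without `∂_t Γ` complete the partial
  -- derivative of `-2 Ric` to a covariant one.
  have hN : ∀ i, -(A.nabRic i + A.nabRic i) = (a i)ᵀ + a i := by
    intro i
    have h1 := congrArg (fun X => X.map D) (A.compat i)
    simp only [map_derivation_add, map_derivation_mul, A.map_D_comm hD, hg] at h1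
    have h2 : (A.chr i)ᵀ.map D = ((A.chr i).map D)ᵀ := rfl
    have h3 : (-(A.Ric + A.Ric)).map (A.d i) = -(A.Ric.map (A.d i) + A.Ric.map (A.d i)) := by
      ext; simp
    rw [h2, h3] at h1
    rw [ha, transpose_mul, A.g_symm, nabRic, nab]
    have h4 := congrArg (fun X => X + (A.chr i)ᵀ * (A.Ric + A.Ric) + (A.Ric + A.Ric) * A.chr i) h1
    calc _ = -(A.Ric.map (A.d i) + A.Ric.map (A.d i)) + (A.chr i)ᵀ * (A.Ric + A.Ric)
          + (A.Ric + A.Ric) * A.chr i := by noncomm_ring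
      _ = _ := by rw [h4]; noncomm_ring
  have h := fun i j k => congrFun (congrFun (hN i) j) k
  simp only [Matrix.neg_apply, Matrix.add_apply, transpose_apply] at h
  -- The Koszul trick again: three permutations of `h`, together with the symmetry `hs`, determine
  -- `a`.
  refine eq_of_two_mul_eq ?_
  change 2 * a i q k = _
  linear_combination -(h i k q) - h k i q + h q i k + hs i q k + hs q k i + hs q i k

/-- The Palatini identity: the curvature is quadratic in the connection, and its variation is the
antisymmetrised covariant derivative of the variation of the connection. -/
theorem g_mul_D_Rm {D : Derivation ℝ K K} (hD : ∀ i f, D (A.d i f) = A.d i (D f)) (i j : ι) :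
    A.g * (A.Rm i j).map D =
      A.nab i (A.g * (A.chr j).map D) - A.nab j (A.g * (A.chr i).map D) := by
  simp only [nab_mul_g, Rm, map_derivation_add, map_derivation_sub, map_derivation_mul,
    A.map_D_comm hD]
  noncomm_ring

/-- The evolution of the Ricci tensor. -/
theorem D_Ric {D : Derivation ℝ K K} (hD : ∀ i f, D (A.d i f) = A.d i (D f))
    (hflow : ∀ i j, D (A.g i j) = -2 * A.Ric i j) (j k : ι) :
    D (A.Ric j k) = A.lap j k + 2 * A.RmRic j k - 2 * (A.Ric * A.gi * A.Ric) j k := by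
  have h1 : D (A.Ric j k) =
      A.tr (Matrix.of fun p q => (A.g * (A.Rm p j).map D) q k) := by
    have e : ∀ p, (A.gi * (A.g * (A.Rm p j).map D)) p k = D (A.Rm p j p k) := fun p => by
      rw [← mul_assoc, A.gi_mul, one_mul, map_apply]
    simp only [Ric, of_apply, map_sum, ← e, mul_entry A.gi, tr]
  -- Insert the evolution of the connection into the Palatini identity. The fourth and fifth terms
  -- are transposes of each other and cancel under the trace.
  have h2 : (Matrix.of fun p q => (A.g * (A.Rm p j).map D) q k) =
      (Matrix.of fun p q => A.nab2Ric p q j k) - (Matrix.of fun p q => A.nab2Ric p j k q)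
      - (Matrix.of fun p q => A.nab2Ric p k j q)
      - (Matrix.of fun p q => A.nab2Ric j p k q)ᵀ + (Matrix.of fun p q => A.nab2Ric j p k q)
      + A.nab2Ric j k := by
    ext p q
    set a : ι → Matrix ι ι K := fun i => A.g * (A.chr i).map D with ha
    have e : ∀ i q k, a i q k = A.nabRic q i k - A.nabRic i k q - A.nabRic k i q :=
      A.g_mul_D_chr hD hflow
    have hc : ∀ p j, A.cov p a j q k =
        A.nab2Ric p q j k - A.nab2Ric p j k q - A.nab2Ric p k j q := by
      intro p j
      simp only [nab2Ric, cov_apply, e, map_sub, mul_sub, Finset.sum_sub_distrib]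
      ring
    rw [of_apply, A.g_mul_D_Rm hD, A.nab_sub_nab p j a, Matrix.sub_apply, hc, hc,
      A.nab2Ric_symm j q p k]
    simp only [Matrix.sub_apply, Matrix.add_apply, of_apply, transpose_apply]
    ring
  rw [h1, h2]
  simp only [tr_add, tr_sub, tr_transpose, tr_nab2Ric_comm, tr_nab2Ric_inner, lap, of_apply]
  rw [A.RmRic_symm k j, A.Ric_gi_Ric_symm k j]
  -- The two commuted terms each contribute half a Hessian, cancelling the full Hessian from
  -- `tr_nab2Ric_inner`.
  refine eq_of_two_mul_eq ?_
  linear_combination A.hess_symm j k - A.two_mul_tr_nab2Ric_outer j k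
    - A.two_mul_tr_nab2Ric_outer k j

/-! ### The curvature of the space-time connection -/

theorem gi_mul_nab (i : ι) (B : Matrix ι ι K) :
    A.gi * A.nab i B =
      (A.gi * B).map (A.d i) + A.chr i * (A.gi * B) - A.gi * B * A.chr i := by
  rw [nab, map_derivation_mul, A.map_d_gi]
  noncomm_ring

theorem curv_space_space_time (p j l : ι) :
    A.d p (-(A.gi * A.Ric) l j) - A.d j (-(A.gi * A.Ric) l p)
      + ∑ m, (-(A.gi * A.Ric) m j * A.chr p l m - -(A.gi * A.Ric) m p * A.chr j l m) =
    -∑ q, A.gi l q * A.P p j q := by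
  have h : ∀ p j, (A.gi * A.nabRic p) l j =
      A.d p ((A.gi * A.Ric) l j) + ∑ m, A.chr p l m * (A.gi * A.Ric) m j
        - ∑ m, (A.gi * A.Ric) l m * A.chr p m j := fun p j => by
    rw [nabRic, gi_mul_nab]
    simp only [Matrix.sub_apply, Matrix.add_apply, mul_entry (A.chr p), mul_entry (A.gi * A.Ric),
      map_apply]
  have h2 : ∑ q, A.gi l q * A.P p j q = (A.gi * A.nabRic p) l j - (A.gi * A.nabRic j) l p := by
    simp only [P, mul_entry A.gi, mul_sub, Finset.sum_sub_distrib, A.nabRic_symm _ j,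
      A.nabRic_symm _ p]
  rw [h2, h, h]
  simp only [A.chr_symm p _ j, map_neg, neg_mul, Finset.sum_sub_distrib, Finset.sum_neg_distrib,
    mul_comm ((A.gi * A.Ric) _ j), mul_comm ((A.gi * A.Ric) _ p)]
  ring

/-- The left side is `-∇_p R_k^l - ∂_t Γ_{pk}^l`; the two copies of `∇_p R_k^l` cancel and the
remaining derivatives form `P`. -/
theorem curv_space_time_space {D : Derivation ℝ K K} (hD : ∀ i f, D (A.d i f) = A.d i (D f))
    (hflow : ∀ i j, D (A.g i j) = -2 * A.Ric i j) (p k l : ι) :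
    A.d p (-(A.gi * A.Ric) l k) - D (A.chr p l k)
      + ∑ m, (-(A.gi * A.Ric) m k * A.chr p l m - A.chr p m k * -(A.gi * A.Ric) l m) =
    ∑ q, A.gi l q * A.P k q p := by
  have h : (A.gi * A.nabRic p) l k =
      A.d p ((A.gi * A.Ric) l k) + ∑ m, A.chr p l m * (A.gi * A.Ric) m k
        - ∑ m, (A.gi * A.Ric) l m * A.chr p m k := by
    rw [nabRic, gi_mul_nab]
    simp only [Matrix.sub_apply, Matrix.add_apply, mul_entry (A.chr p), mul_entry (A.gi * A.Ric),
      map_apply]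
  have h2 : D (A.chr p l k) = (A.gi * (A.g * (A.chr p).map D)) l k := by
    rw [← mul_assoc, A.gi_mul, one_mul, map_apply]
  have h3 : ∑ q, A.gi l q * A.P k q p =
      -(A.gi * A.nabRic p) l k - (A.gi * (A.g * (A.chr p).map D)) l k := by
    simp only [mul_entry A.gi, A.g_mul_D_chr hD hflow, ← Finset.sum_neg_distrib,
      ← Finset.sum_sub_distrib, P]
    refine Finset.sum_congr rfl fun q _ => ?_
    rw [A.nabRic_symm p k q, A.nabRic_symm k p q, A.nabRic_symm q p k]
    ring
  rw [h3, h, h2]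
  simp only [map_neg, neg_mul, mul_neg, Finset.sum_sub_distrib, Finset.sum_neg_distrib,
    mul_comm ((A.gi * A.Ric) _ k), mul_comm ((A.gi * A.Ric) l _)]
  ring

/-- The gradient of the scalar curvature. -/
def grad (l : ι) : K := ∑ q, A.gi l q * A.d q A.scalar

theorem curv_space_time_time {D : Derivation ℝ K K} (hD : ∀ i f, D (A.d i f) = A.d i (D f))
    (hflow : ∀ i j, D (A.g i j) = -2 * A.Ric i j) (p l : ι) :
    A.d p (-((1 / 2 : ℝ) • A.grad l)) - D (-(A.gi * A.Ric) l p)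
      + ∑ m, (-((1 / 2 : ℝ) • A.grad m) * A.chr p l m
        - -(A.gi * A.Ric) m p * -(A.gi * A.Ric) l m) =
    ∑ q, A.gi l q * A.M p q := by
  have hgrad : A.d p (A.grad l) + ∑ m, A.chr p l m * A.grad m = (A.gi * A.hess) l p := by
    have e := fun q => congrFun (congrFun (A.map_d_gi p) l) q
    simp only [Matrix.sub_apply, Matrix.neg_apply, map_apply] at e
    simp only [grad, map_sum, Derivation.leibniz, smul_eq_mul, e, mul_entry, hess, of_apply,
      transpose_apply, mul_sub, Finset.sum_add_distrib, Finset.sum_sub_distrib, Finset.mul_sum,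
      mul_neg, Finset.sum_neg_distrib]
    have e1 : ∑ x, ∑ y, A.d x A.scalar * (A.gi l y * A.chr p x y) =
        ∑ x, ∑ y, A.gi l x * (A.chr p y x * A.d y A.scalar) := by
      rw [Finset.sum_comm]
      exact Finset.sum_congr rfl fun _ _ => Finset.sum_congr rfl fun _ _ => by ring
    have e2 : ∑ x, ∑ y, A.d x A.scalar * (A.chr p l y * A.gi y x) =
        ∑ x, ∑ y, A.chr p l x * (A.gi x y * A.d y A.scalar) := by
      rw [Finset.sum_comm]
      exact Finset.sum_congr rfl fun _ _ => Finset.sum_congr rfl fun _ _ => by ring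
    rw [e1, e2]
    simp only [A.chr_symm _ _ p, A.d_comm _ p]
    ring
  have hg : A.g.map D = -(A.Ric + A.Ric) := by
    ext i j
    simp only [map_apply, hflow, Matrix.neg_apply, Matrix.add_apply]
    ring
  -- `M` differs from the evolution of the Ricci tensor only by half the Hessian and one Ricci
  -- square.
  have hR : A.Ric.map D = A.M + (1 / 2 : ℝ) • A.hess - A.Ric * A.gi * A.Ric := by
    ext i j
    rw [map_apply, A.D_Ric hD hflow]
    simp only [Matrix.sub_apply, Matrix.add_apply, Matrix.smul_apply, M, of_apply]
    ring
  -- Differentiating the inverse metric adds two Ricci squares, so the sign of the square flips. The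
  -- quadratic term of the space-time curvature then removes it.
  have hU : (A.gi * A.Ric).map D =
      A.gi * A.M + (1 / 2 : ℝ) • (A.gi * A.hess) + (A.gi * A.Ric) * (A.gi * A.Ric) := by
    rw [map_derivation_mul, A.map_gi, hg, hR, ← Matrix.mul_smul]
    noncomm_ring
  have hU' := congrFun (congrFun hU l) p
  rw [Matrix.add_apply, Matrix.add_apply, Matrix.smul_apply, ← hgrad, map_apply,
    mul_entry (A.gi * A.Ric)] at hU'
  have hM : ∑ q, A.gi l q * A.M p q = (A.gi * A.M) l p := by
    simp only [mul_apply, A.M_symm p]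
  rw [hM]
  simp only [map_neg, Derivation.map_smul, neg_mul, mul_neg, Finset.sum_sub_distrib, Finset.sum_neg_distrib,
    smul_mul_assoc, ← Finset.smul_sum, hU', smul_add, mul_comm (A.grad _),
    mul_comm ((A.gi * A.Ric) l _)]
  ring

end MetricAlg

/-! ### The algebra of smooth functions on a set -/

section SmoothFun

variable {E : Type*} [NormedAddCommGroup E] [NormedSpace ℝ E] {S : Set E}

/-- The extension by zero of a function on `S`. -/
def extendZero (f : S → ℝ) : E → ℝ := Function.extend Subtype.val f 0

theorem extendZero_apply {E : Type*} {S : Set E} (f : S → ℝ) (p : S) : extendZero f p = f p :=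
  Subtype.val_injective.extend_apply _ _ _

theorem contDiffOn_extendZero_congr {f : S → ℝ} {F : E → ℝ} (h : ∀ p : S, F p = f p) :
    ContDiffOn ℝ ∞ (extendZero f) S ↔ ContDiffOn ℝ ∞ F S :=
  contDiffOn_congr fun p hp => by
    rw [extendZero_apply f ⟨p, hp⟩, ← h]

variable (S) in
/-- The algebra of the functions on `S` that are smooth within `S`. -/
def smoothFun : Subalgebra ℝ (S → ℝ) where
  carrier := {f | ContDiffOn ℝ ∞ (extendZero f) S}
  mul_mem' {f g} hf hg := (contDiffOn_extendZero_congr (F := extendZero f * extendZero g)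
    fun p => by simp [extendZero_apply]).2 (ContDiffOn.mul hf hg)
  add_mem' {f g} hf hg := (contDiffOn_extendZero_congr (F := extendZero f + extendZero g)
    fun p => by simp [extendZero_apply]).2 (ContDiffOn.add hf hg)
  algebraMap_mem' r := (contDiffOn_extendZero_congr (F := fun _ => r)
    fun p => by simp).2 contDiffOn_const

theorem smoothFun.contDiffOn (f : smoothFun S) : ContDiffOn ℝ ∞ (extendZero f.1) S := f.2

/-- The element of `smoothFun S` given by a function that is smooth within `S`. -/
def smoothFun.mk (F : E → ℝ) (hF : ContDiffOn ℝ ∞ F S) : smoothFun S :=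
  ⟨fun p => F p, (contDiffOn_extendZero_congr fun _ => rfl).2 hF⟩

/-- Evaluation at a point of `S`. -/
def smoothFun.ev (p : S) : smoothFun S →ₐ[ℝ] ℝ :=
  (Pi.evalAlgHom ℝ (fun _ : S => ℝ) p).comp (smoothFun S).val

@[ext] theorem smoothFun.ext_ev {f g : smoothFun S} (h : ∀ p, smoothFun.ev p f = smoothFun.ev p g) :
    f = g :=
  Subtype.ext (funext h)

theorem smoothFun.extendZero_eq_ev (f : smoothFun S) (p : S) : extendZero f.1 p = ev p f :=
  extendZero_apply _ _

/-- Applied to the determinant, this puts the inverse metric in the same algebra. -/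
theorem smoothFun.isUnit_of_ev_ne_zero (f : smoothFun S) (hf : ∀ p, ev p f ≠ 0) : IsUnit f := by
  refine IsUnit.of_mul_eq_one (smoothFun.mk (extendZero f.1)⁻¹ ((smoothFun.contDiffOn f).inv fun p hp => ?_)) ?_
  · rw [extendZero_eq_ev f ⟨p, hp⟩]
    exact hf _
  · ext p
    rw [map_mul, map_one]
    change ev p f * (extendZero f.1 p)⁻¹ = 1
    rw [extendZero_eq_ev, mul_inv_cancel₀ (hf p)]

/-- The derivative in the direction of a vector, as a derivation of `smoothFun S`. -/
def dirDeriv (hS : UniqueDiffOn ℝ S) (v : E) : Derivation ℝ (smoothFun S) (smoothFun S) :=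
  Derivation.mk'
    { toFun := fun f => smoothFun.mk (fun p => fderivWithin ℝ (extendZero f.1) S p v)
        (((smoothFun.contDiffOn f).fderivWithin hS (by simp)).clm_apply contDiffOn_const)
      map_add' := fun f g => by
        ext p
        rw [map_add]
        change fderivWithin ℝ (extendZero (f + g).1) S p v =
          fderivWithin ℝ (extendZero f.1) S p v + fderivWithin ℝ (extendZero g.1) S p v
        rw [fderivWithin_congr' (f := extendZero f.1 + extendZero g.1) _ p.2,
          fderivWithin_add (hS _ p.2) ((smoothFun.contDiffOn f).differentiableOn (by simp) _ p.2)
            ((smoothFun.contDiffOn g).differentiableOn (by simp) _ p.2)]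
        · rfl
        · intro q hq
          refine (smoothFun.extendZero_eq_ev (f + g) ⟨q, hq⟩).trans ?_
          simp [smoothFun.extendZero_eq_ev f ⟨q, hq⟩,
            smoothFun.extendZero_eq_ev g ⟨q, hq⟩]
      map_smul' := fun c f => by
        ext p
        rw [map_smul]
        change fderivWithin ℝ (extendZero (c • f).1) S p v =
          c * fderivWithin ℝ (extendZero f.1) S p v
        rw [fderivWithin_congr' (f := c • extendZero f.1) _ p.2,
          fderivWithin_const_smul (hS _ p.2) ((smoothFun.contDiffOn f).differentiableOn (by simp) _ p.2)]
        · rfl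
        · intro q hq
          refine (smoothFun.extendZero_eq_ev (c • f) ⟨q, hq⟩).trans ?_
          simp [smoothFun.extendZero_eq_ev f ⟨q, hq⟩] }
    fun f g => by
      ext p
      change fderivWithin ℝ (extendZero (f * g).1) S p v =
        smoothFun.ev p f * fderivWithin ℝ (extendZero g.1) S p v +
        smoothFun.ev p g * fderivWithin ℝ (extendZero f.1) S p v
      rw [fderivWithin_congr' (f := extendZero f.1 * extendZero g.1) _ p.2,
        fderivWithin_mul (hS _ p.2) ((smoothFun.contDiffOn f).differentiableOn (by simp) _ p.2)
          ((smoothFun.contDiffOn g).differentiableOn (by simp) _ p.2)]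
      · simp [smoothFun.extendZero_eq_ev f, smoothFun.extendZero_eq_ev g]
      · intro q hq
        refine (smoothFun.extendZero_eq_ev (f * g) ⟨q, hq⟩).trans ?_
        simp [smoothFun.extendZero_eq_ev f ⟨q, hq⟩,
          smoothFun.extendZero_eq_ev g ⟨q, hq⟩]

theorem ev_dirDeriv (hS : UniqueDiffOn ℝ S) (v : E) (f : smoothFun S) (p : S) :
    smoothFun.ev p (dirDeriv hS v f) = fderivWithin ℝ (extendZero f.1) S p v := rfl

/-- Symmetry of the second derivative within `S`. It extends to boundary points, hence to the
initial time, because they are limits of interior points. -/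
theorem dirDeriv_comm (hS : UniqueDiffOn ℝ S) (hS' : S ⊆ closure (interior S)) (v w : E) (f : smoothFun S) :
    dirDeriv hS v (dirDeriv hS w f) = dirDeriv hS w (dirDeriv hS v f) := by
  have key : ∀ (v w : E) (p : S), smoothFun.ev p (dirDeriv hS v (dirDeriv hS w f)) =
      fderivWithin ℝ (fderivWithin ℝ (extendZero f.1) S) S p v w := by
    intro v w p
    rw [ev_dirDeriv, fderivWithin_congr' (f := fun q => fderivWithin ℝ (extendZero f.1) S q w) _ p.2,
      fderivWithin_clm_apply (hS _ p.2)
        (((smoothFun.contDiffOn f).fderivWithin hS (m := ∞) (by simp)).differentiableOn (by simp) _ p.2)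
        (differentiableWithinAt_const _)]
    · simp
    · intro q hq
      exact (smoothFun.extendZero_eq_ev (dirDeriv hS w f) ⟨q, hq⟩)
  ext p
  rw [key, key]
  exact ((smoothFun.contDiffOn f) _ p.2).isSymmSndFDerivWithinAt
    (by rw [minSmoothness_of_isRCLikeNormedField]; exact ENat.LEInfty.out) hS (hS' p.2) p.2 v w

end SmoothFun

/-! ### Partial derivatives as derivations of the algebra of smooth functions. -/

section Slices

variable {n : ℕ} {Ω : Set (Model n)} {I : Set ℝ}

theorem pd_eq_ev_dirDeriv (hΩ : IsOpen Ω) (hS : UniqueDiffOn ℝ (Ω ×ˢ I)) (f : smoothFun (Ω ×ˢ I))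
    {F : Model n × ℝ → ℝ} (hF : ∀ p : ↑(Ω ×ˢ I), F p = smoothFun.ev p f) (i : Fin n)
    (p : ↑(Ω ×ˢ I)) :
    pd i (fun z => F (z, p.1.2)) p.1.1 =
      smoothFun.ev p (dirDeriv hS (EuclideanSpace.single i 1, 0) f) := by
  obtain ⟨⟨y, s⟩, hy, hs⟩ := p
  have h1 : HasFDerivWithinAt (extendZero f.1) (fderivWithin ℝ (extendZero f.1) (Ω ×ˢ I) (y, s))
      (Ω ×ˢ I) (y, s) :=
    ((smoothFun.contDiffOn f).differentiableOn (by simp) _ ⟨hy, hs⟩).hasFDerivWithinAt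
  have h2 : HasFDerivWithinAt (fun z : Model n => (z, s)) (ContinuousLinearMap.inl ℝ (Model n) ℝ)
      Ω y := (hasFDerivAt_prodMk_left y s).hasFDerivWithinAt
  have h3 := (h1.comp y h2 (show Set.MapsTo _ Ω (Ω ×ˢ I) from fun z hz => ⟨hz, hs⟩)).hasFDerivAt (hΩ.mem_nhds hy)
  have h4 : (fun z => F (z, s)) =ᶠ[nhds y] extendZero f.1 ∘ fun z => (z, s) := by
    filter_upwards [hΩ.mem_nhds hy] with z hz
    rw [hF ⟨(z, s), hz, hs⟩, ← smoothFun.extendZero_eq_ev]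
    rfl
  rw [pd, (h3.congr_of_eventuallyEq h4).fderiv, ev_dirDeriv]
  rfl

/-- The translate of `J` need only lie inside `I`: at the left end of `[0, T - τ)` the derivative is
one-sided even if `τ` is interior to `[0, T)`, and unique differentiability makes the two agree. -/
theorem derivWithin_eq_ev_dirDeriv (hS : UniqueDiffOn ℝ (Ω ×ˢ I)) (f : smoothFun (Ω ×ˢ I))
    {F : Model n × ℝ → ℝ} (hF : ∀ p : ↑(Ω ×ˢ I), F p = smoothFun.ev p f) (p : ↑(Ω ×ˢ I))
    {J : Set ℝ} {τ t : ℝ} (hJ : UniqueDiffWithinAt ℝ J t) (hp : p.1.2 = t + τ)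
    (hJI : ∀ s ∈ J, s + τ ∈ I) :
    derivWithin (fun s => F (p.1.1, s + τ)) J t = smoothFun.ev p (dirDeriv hS (0, 1) f) := by
  obtain ⟨⟨y, s⟩, hy, hs⟩ := p
  obtain rfl : s = t + τ := hp
  have h1 : HasFDerivWithinAt (extendZero f.1)
      (fderivWithin ℝ (extendZero f.1) (Ω ×ˢ I) (y, t + τ)) (Ω ×ˢ I) (y, t + τ) :=
    ((smoothFun.contDiffOn f).differentiableOn (by simp) _ ⟨hy, hs⟩).hasFDerivWithinAt
  have h2 : HasDerivWithinAt (fun s : ℝ => (y, s + τ)) ((0 : Model n), (1 : ℝ)) J t :=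
    ((hasDerivAt_const t y).prodMk ((hasDerivAt_id t).add_const τ)).hasDerivWithinAt
  have h3 := h1.comp_hasDerivWithinAt_of_eq t h2 (fun s hs => ⟨hy, hJI s hs⟩) rfl
  rw [ev_dirDeriv, ← h3.derivWithin hJ]
  refine derivWithin_congr (fun s hs => ?_) ?_
  · rw [hF ⟨(y, s + τ), hy, hJI s hs⟩, ← smoothFun.extendZero_eq_ev]
    rfl
  · rw [hF ⟨(y, t + τ), hy, hs⟩, ← smoothFun.extendZero_eq_ev]
    rfl

end Slices

/-! ### Coordinate tensors as values of the algebraic ones. -/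

/-- A smooth solution of the Ricci flow in a coordinate domain `Ω` over a time interval `I`. -/
structure CoordFlow (n : ℕ) where
  Ω : Set (Model n)
  I : Set ℝ
  G : ℝ → Model n → Matrix (Fin n) (Fin n) ℝ
  isOpen : IsOpen Ω
  convex : Convex ℝ I
  nonempty_interior : (interior I).Nonempty
  smooth : ∀ i j, ContDiffOn ℝ ∞ (fun p : Model n × ℝ => G p.2 p.1 i j) (Ω ×ˢ I)
  symm : ∀ y ∈ Ω, ∀ t ∈ I, (G t y)ᵀ = G t y
  det_ne_zero : ∀ y ∈ Ω, ∀ t ∈ I, (G t y).det ≠ 0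
  flow : ∀ y ∈ Ω, ∀ t ∈ I, ∀ i j,
    HasDerivWithinAt (fun s => G s y i j) (-2 * ricci (G t) i j y) I t

namespace CoordFlow

variable {n : ℕ} (F : CoordFlow n)

/-- The coordinate domain of space-time. -/
def S : Set (Model n × ℝ) := F.Ω ×ˢ F.I

theorem uniqueDiffOn_S : UniqueDiffOn ℝ F.S :=
  F.isOpen.uniqueDiffOn.prod (uniqueDiffOn_convex F.convex F.nonempty_interior)

theorem S_subset : F.S ⊆ closure (interior F.S) := by
  rw [S, interior_prod_eq, closure_prod_eq, F.isOpen.interior_eq,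
    F.convex.closure_interior_eq_closure_of_nonempty_interior F.nonempty_interior]
  exact Set.prod_mono subset_closure subset_closure

/-- The spatial coordinate derivatives. -/
def dSpace (i : Fin n) : Derivation ℝ (smoothFun F.S) (smoothFun F.S) :=
  dirDeriv F.uniqueDiffOn_S (EuclideanSpace.single i 1, 0)

/-- The time derivative. -/
def dTime : Derivation ℝ (smoothFun F.S) (smoothFun F.S) :=
  dirDeriv F.uniqueDiffOn_S (0, 1)

/-- The metric as a matrix over the algebra of smooth functions. -/
def gMat : Matrix (Fin n) (Fin n) (smoothFun F.S) :=
  Matrix.of fun i j => smoothFun.mk (fun p => F.G p.2 p.1 i j) (F.smooth i j)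

theorem ev_gMat (q : F.S) (i j : Fin n) :
    F.G q.1.2 q.1.1 i j = smoothFun.ev q (F.gMat i j) := rfl

theorem map_ev_gMat (q : F.S) : F.gMat.map (smoothFun.ev q) = F.G q.1.2 q.1.1 := rfl

theorem isUnit_det : IsUnit F.gMat.det := by
  refine smoothFun.isUnit_of_ev_ne_zero _ fun q => ?_
  rw [AlgHom.map_det, AlgHom.mapMatrix_apply, map_ev_gMat]
  exact F.det_ne_zero _ q.2.1 _ q.2.2

/-- The algebraic metric data of the flow. -/
def alg : MetricAlg (Fin n) (smoothFun F.S) where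
  d := F.dSpace
  d_comm i j f := dirDeriv_comm F.uniqueDiffOn_S F.S_subset _ _ f
  g := F.gMat
  gi := F.gMat⁻¹
  g_symm := by
    ext i j q
    rw [transpose_apply, ← ev_gMat, ← ev_gMat]
    exact congrFun (congrFun (F.symm _ q.2.1 _ q.2.2) i) j
  gi_mul := nonsing_inv_mul _ F.isUnit_det

theorem dTime_comm (i : Fin n) (f : smoothFun F.S) :
    F.dTime (F.alg.d i f) = F.alg.d i (F.dTime f) :=
  dirDeriv_comm F.uniqueDiffOn_S F.S_subset _ _ f

/-- The inductive step behind the `ev_` lemmas: agreement at every point of `S`, not just at `q`, is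
what survives differentiation. -/
theorem pd_eq (H : ℝ → Model n → ℝ) {f : smoothFun F.S}
    (hH : ∀ p : F.S, H p.1.2 p.1.1 = smoothFun.ev p f) (i : Fin n) (q : F.S) :
    pd i (H q.1.2) q.1.1 = smoothFun.ev q (F.alg.d i f) :=
  pd_eq_ev_dirDeriv (F := fun p => H p.2 p.1) F.isOpen F.uniqueDiffOn_S f hH i q

theorem ev_g (q : F.S) (i j : Fin n) :
    F.G q.1.2 q.1.1 i j = smoothFun.ev q (F.alg.g i j) := rfl

theorem ev_gi (q : F.S) (i j : Fin n) :
    ginv (F.G q.1.2) i j q.1.1 = smoothFun.ev q (F.alg.gi i j) := by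
  have h : (F.alg.gi.map (smoothFun.ev q)) * F.G q.1.2 q.1.1 = 1 := by
    have := congrArg (fun X => X.map (smoothFun.ev q)) F.alg.gi_mul
    rwa [Matrix.map_mul, Matrix.map_one _ (map_zero _) (map_one _)] at this
  rw [ginv, inv_eq_left_inv h, map_apply]

theorem ev_chr (q : F.S) (i j k : Fin n) :
    christoffel (F.G q.1.2) i j k q.1.1 = smoothFun.ev q (F.alg.chr i k j) := by
  have h : ∀ i j k, pd i (fun z => F.G q.1.2 z j k) q.1.1 =
      smoothFun.ev q (F.alg.d i (F.alg.g j k)) := fun i j k =>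
    F.pd_eq (fun s y => F.G s y j k) (fun p => F.ev_g p j k) i q
  simp only [christoffel, MetricAlg.chr, of_apply, map_smul, map_sum, map_mul, map_add, map_sub,
    F.ev_gi, smul_eq_mul, h]

theorem ev_Rm (q : F.S) (i j k l : Fin n) :
    riem (F.G q.1.2) i j k l q.1.1 = smoothFun.ev q (F.alg.Rm i j l k) := by
  have h : ∀ i j k l, pd i (christoffel (F.G q.1.2) j k l) q.1.1 =
      smoothFun.ev q (F.alg.d i (F.alg.chr j l k)) := fun i j k l =>
    F.pd_eq (fun s => christoffel (F.G s) j k l) (fun p => F.ev_chr p j k l) i q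
  simp only [riem, curvature, MetricAlg.Rm, Matrix.add_apply, Matrix.sub_apply, mul_entry,
    map_apply, map_add, map_sub, map_sum, map_mul,
    h, F.ev_chr, Finset.sum_sub_distrib, mul_comm]

theorem ev_RL (q : F.S) (i j k l : Fin n) :
    riemLow (F.G q.1.2) i j k l q.1.1 = smoothFun.ev q (F.alg.RL i j l k) := by
  simp only [riemLow, MetricAlg.RL, mul_entry, map_sum, map_mul, F.ev_Rm, F.ev_g]

theorem ev_Ric (q : F.S) (j k : Fin n) :
    ricci (F.G q.1.2) j k q.1.1 = smoothFun.ev q (F.alg.Ric j k) := by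
  simp only [ricci, MetricAlg.Ric, of_apply, map_sum, F.ev_Rm]

theorem ev_scalar (q : F.S) :
    scal (F.G q.1.2) q.1.1 = smoothFun.ev q F.alg.scalar := by
  simp only [scal, MetricAlg.scalar, MetricAlg.tr, map_sum, map_mul, F.ev_gi, F.ev_Ric]

theorem ev_ricciUp (q : F.S) (i k : Fin n) :
    ricciUp (F.G q.1.2) i k q.1.1 = smoothFun.ev q ((F.alg.gi * F.alg.Ric) k i) := by
  simp only [ricciUp, mul_entry, map_sum, map_mul, F.ev_gi, F.ev_Ric, F.alg.Ric_apply_symm i]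

theorem ev_grad (q : F.S) (k : Fin n) :
    gradScal (F.G q.1.2) k q.1.1 = smoothFun.ev q (F.alg.grad k) := by
  simp only [gradScal, MetricAlg.grad, map_sum, map_mul, F.ev_gi,
    F.pd_eq (fun s => scal (F.G s)) F.ev_scalar]

theorem ev_hess (q : F.S) (i j : Fin n) :
    hessScal (F.G q.1.2) i j q.1.1 = smoothFun.ev q (F.alg.hess i j) := by
  have h : ∀ (k : Fin n) (p : F.S), pd k (scal (F.G p.1.2)) p.1.1 =
      smoothFun.ev p (F.alg.d k F.alg.scalar) := fun k p =>
    F.pd_eq (fun s => scal (F.G s)) F.ev_scalar k p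
  simp only [hessScal, nabla₁, MetricAlg.hess, of_apply, map_sub, map_sum, map_mul, F.ev_chr, h,
    F.pd_eq (fun s => pd j (scal (F.G s))) (h j)]

theorem ev_nabRic (q : F.S) (i j k : Fin n) :
    nabla₂ (F.G q.1.2) (ricci (F.G q.1.2)) i j k q.1.1 = smoothFun.ev q (F.alg.nabRic i j k) := by
  simp only [nabla₂, MetricAlg.nabRic, MetricAlg.nab_apply, map_sub, map_sum, map_mul, F.ev_chr,
    F.ev_Ric,
    F.pd_eq (fun s => ricci (F.G s) j k) (fun p => F.ev_Ric p j k)]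

theorem ev_nab2Ric (q : F.S) (i j k l : Fin n) :
    nabla₃ (F.G q.1.2) (nabla₂ (F.G q.1.2) (ricci (F.G q.1.2))) i j k l q.1.1 =
      smoothFun.ev q (F.alg.nab2Ric i j k l) := by
  simp only [nabla₃, MetricAlg.nab2Ric, MetricAlg.cov_apply, map_sub, map_sum, map_mul, F.ev_chr,
    F.ev_nabRic,
    F.pd_eq (fun s => nabla₂ (F.G s) (ricci (F.G s)) j k l) (fun p => F.ev_nabRic p j k l)]

theorem ev_P (q : F.S) (i j k : Fin n) :
    tensorP (F.G q.1.2) i j k q.1.1 = smoothFun.ev q (F.alg.P i j k) := by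
  simp only [tensorP, MetricAlg.P, map_sub, F.ev_nabRic]

theorem ev_lap (q : F.S) (i j : Fin n) :
    lapRicci (F.G q.1.2) i j q.1.1 = smoothFun.ev q (F.alg.lap i j) := by
  simp only [lapRicci, MetricAlg.lap, MetricAlg.tr, of_apply, map_sum, map_mul, F.ev_gi,
    F.ev_nab2Ric]

theorem ev_M (q : F.S) (i j : Fin n) :
    tensorM (F.G q.1.2) i j q.1.1 = smoothFun.ev q (F.alg.M i j) := by
  have h1 : ∑ k, ∑ l, ∑ p, ∑ r, ginv (F.G q.1.2) k p q.1.1 * ginv (F.G q.1.2) l r q.1.1 *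
      riemLow (F.G q.1.2) k i j l q.1.1 * ricci (F.G q.1.2) p r q.1.1 =
      smoothFun.ev q (F.alg.RmRic i j) := by
    simp only [MetricAlg.RmRic, MetricAlg.RicUp2, of_apply, mul_entry, map_sum, map_mul, F.ev_gi,
      F.ev_RL, F.ev_Ric, Finset.mul_sum, Finset.sum_mul]
    refine Finset.sum_congr rfl fun k _ => Finset.sum_congr rfl fun l _ => ?_
    rw [Finset.sum_comm]
    refine Finset.sum_congr rfl fun r _ => Finset.sum_congr rfl fun p _ => ?_
    rw [F.alg.gi_apply_symm l r]
    ring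
  have h2 : ∑ k, ∑ l, ginv (F.G q.1.2) k l q.1.1 * ricci (F.G q.1.2) i k q.1.1 *
      ricci (F.G q.1.2) l j q.1.1 = smoothFun.ev q ((F.alg.Ric * F.alg.gi * F.alg.Ric) i j) := by
    simp only [mul_entry, map_sum, map_mul, F.ev_gi, F.ev_Ric, Finset.sum_mul]
    rw [Finset.sum_comm]
    refine Finset.sum_congr rfl fun r _ => Finset.sum_congr rfl fun p _ => ?_
    ring
  rw [tensorM, h1, h2, MetricAlg.M, of_apply, F.ev_lap, F.ev_hess]
  simp only [map_sub, map_add, map_smul, map_mul, map_ofNat, smul_eq_mul]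

theorem dTime_g (i j : Fin n) : F.dTime (F.alg.g i j) = -2 * F.alg.Ric i j := by
  refine smoothFun.ext_ev fun q => ?_
  have hJ : UniqueDiffWithinAt ℝ F.I q.1.2 :=
    uniqueDiffOn_convex F.convex F.nonempty_interior _ q.2.2
  have h := derivWithin_eq_ev_dirDeriv (F := fun p => F.G p.2 p.1 i j) F.uniqueDiffOn_S
    (F.alg.g i j) (fun p => F.ev_g p i j) q
    (J := F.I) (τ := 0) hJ (add_zero _).symm (fun s hs => by simpa using hs)
  simp only [add_zero] at h
  refine h.symm.trans ?_
  rw [(F.flow _ q.2.1 _ q.2.2 i j).derivWithin hJ, F.ev_Ric, map_mul, map_neg, map_ofNat]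

end CoordFlow

/-! ### The space-time curvature operator in coordinates. -/

theorem sum_option_split {n : ℕ}
    (Φ : Option (Fin n) → Option (Fin n) → Option (Fin n) → Option (Fin n) → ℝ)
    (h₁ : ∀ j k l, Φ none j k l = 0) (h₂ : ∀ i j k, Φ i j k none = 0) :
    ∑ i, ∑ j, ∑ k, ∑ l, Φ i j k l =
      ∑ i, ∑ l, Φ (some i) none none (some l)
      + ∑ k, ∑ i, ∑ l, Φ (some i) none (some k) (some l)
      + ∑ j, ∑ i, ∑ l, Φ (some i) (some j) none (some l)
      + ∑ j, ∑ k, ∑ i, ∑ l, Φ (some i) (some j) (some k) (some l) := by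
  simp only [Fintype.sum_option, h₁, h₂, Finset.sum_const_zero, zero_add, Finset.sum_add_distrib]
  have e1 : ∑ i, ∑ k, ∑ l, Φ (some i) none (some k) (some l) =
      ∑ k, ∑ i, ∑ l, Φ (some i) none (some k) (some l) := Finset.sum_comm
  have e2 : ∑ i, ∑ j, ∑ l, Φ (some i) (some j) none (some l) =
      ∑ j, ∑ i, ∑ l, Φ (some i) (some j) none (some l) := Finset.sum_comm
  have e3 : ∑ i, ∑ j, ∑ k, ∑ l, Φ (some i) (some j) (some k) (some l) =
      ∑ j, ∑ k, ∑ i, ∑ l, Φ (some i) (some j) (some k) (some l) :=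
    Finset.sum_comm.trans (Finset.sum_congr rfl fun j _ => Finset.sum_comm)
  rw [e1, e2, e3]
  ring

/-- Moves the two inverse metrics from the curvature onto the forms; it serves all four blocks. -/
theorem sum_raise_raise {n : ℕ} (γ X : Fin n → Fin n → ℝ) (Y Z : Fin n → ℝ) :
    ∑ i, ∑ l, (∑ p, γ i p * ∑ m, γ l m * X p m) * Y i * Z l =
      ∑ p, ∑ m, X p m * (∑ i, γ i p * Y i) * ∑ l, γ l m * Z l := by
  have h1 : ∀ i l, (∑ p, γ i p * ∑ m, γ l m * X p m) * Y i * Z l =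
      ∑ p, ∑ m, X p m * (γ i p * Y i) * (γ l m * Z l) := fun i l => by
    simp only [Finset.mul_sum, Finset.sum_mul]
    exact Finset.sum_congr rfl fun _ _ => Finset.sum_congr rfl fun _ _ => by ring
  have h2 : ∀ p m, X p m * (∑ i, γ i p * Y i) * ∑ l, γ l m * Z l =
      ∑ i, ∑ l, X p m * (γ i p * Y i) * (γ l m * Z l) := fun p m => by
    rw [mul_assoc, Finset.sum_mul_sum, Finset.mul_sum]
    simp only [Finset.mul_sum, mul_assoc]
  simp only [h1, h2]
  exact sum_pair_comm _

namespace CoordFlow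

variable {n : ℕ} (F : CoordFlow n)

/-- The Christoffel symbols of the space-time connection. -/
def stGamma : Option (Fin n) → Option (Fin n) → Option (Fin n) → smoothFun F.S
  | some i, some j, some k => F.alg.chr i k j
  | some i, none, some k => -(F.alg.gi * F.alg.Ric) k i
  | none, some i, some k => -(F.alg.gi * F.alg.Ric) k i
  | none, none, some k => -((1 / 2 : ℝ) • F.alg.grad k)
  | _, _, none => 0

/-- The coordinate derivatives of space-time. -/
def stD : Option (Fin n) → Derivation ℝ (smoothFun F.S) (smoothFun F.S)
  | some i => F.alg.d i
  | none => F.dTime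

variable {T : EReal} {τ t : ℝ}

theorem ev_stGamma (q : F.S) (hq : q.1.2 = t + τ) (a b c : Option (Fin n)) :
    stChristoffel F.G τ a b c (q.1.1, t) = smoothFun.ev q (F.stGamma a b c) := by
  rcases a with _ | i <;> rcases b with _ | j <;> rcases c with _ | k <;>
    simp only [stChristoffel, stGamma, ← hq, map_zero, map_neg, map_smul, F.ev_chr, F.ev_ricciUp,
      F.ev_grad, smul_eq_mul, neg_mul]

theorem stPd_stGamma (q : F.S) (hq : q.1.2 = t + τ)
    (hJ : UniqueDiffWithinAt ℝ (shiftedInterval T τ) t)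
    (hJI : ∀ s ∈ shiftedInterval T τ, s + τ ∈ F.I) (a b c d : Option (Fin n)) :
    stPd (shiftedInterval T τ) a (stChristoffel F.G τ b c d) (q.1.1, t) =
      smoothFun.ev q (F.stD a (F.stGamma b c d)) := by
  have h : ∀ p : F.S, stChristoffel F.G τ b c d (p.1.1, p.1.2 - τ) =
      smoothFun.ev p (F.stGamma b c d) := fun p => F.ev_stGamma p (by ring) b c d
  rcases a with _ | i
  · have := derivWithin_eq_ev_dirDeriv
      (F := fun p : Model n × ℝ => stChristoffel F.G τ b c d (p.1, p.2 - τ))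
      F.uniqueDiffOn_S _ h q hJ hq hJI
    simp only [add_sub_cancel_right] at this
    exact this
  · have := F.pd_eq (fun s z => stChristoffel F.G τ b c d (z, s - τ)) h i q
    simp only [hq, add_sub_cancel_right] at this
    exact this

theorem stRiem_eq (q : F.S) (hq : q.1.2 = t + τ)
    (hJ : UniqueDiffWithinAt ℝ (shiftedInterval T τ) t)
    (hJI : ∀ s ∈ shiftedInterval T τ, s + τ ∈ F.I) (a b c d : Option (Fin n)) :
    stRiem F.G T τ a b c d (q.1.1, t) = smoothFun.ev q
      (F.stD a (F.stGamma b c d) - F.stD b (F.stGamma a c d)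
        + ∑ m, (F.stGamma b c m * F.stGamma a m d - F.stGamma a c m * F.stGamma b m d)) := by
  simp only [stRiem, curvature, F.stPd_stGamma q hq hJ hJI, F.ev_stGamma q hq, map_add, map_sub,
    map_sum, map_mul]

section Components

variable (q : F.S) (hq : q.1.2 = t + τ) (hJ : UniqueDiffWithinAt ℝ (shiftedInterval T τ) t)
  (hJI : ∀ s ∈ shiftedInterval T τ, s + τ ∈ F.I)

include hq hJ hJI

theorem stRiem_space (p j k l : Fin n) :
    stRiem F.G T τ (some p) (some j) (some k) (some l) (q.1.1, t) =
      ∑ m, ginv (F.G q.1.2) l m q.1.1 * riemLow (F.G q.1.2) p j k m q.1.1 := by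
  have h : F.stD (some p) (F.stGamma (some j) (some k) (some l))
      - F.stD (some j) (F.stGamma (some p) (some k) (some l))
      + ∑ m, (F.stGamma (some j) (some k) m * F.stGamma (some p) m (some l)
        - F.stGamma (some p) (some k) m * F.stGamma (some j) m (some l)) =
      (F.alg.gi * F.alg.RL p j) l k := by
    rw [F.alg.gi_mul_RL]
    simp only [Fintype.sum_option, stD, stGamma, MetricAlg.Rm, Matrix.add_apply, Matrix.sub_apply,
      map_apply, mul_entry, zero_mul, zero_add, Finset.sum_sub_distrib, mul_comm]
  rw [F.stRiem_eq q hq hJ hJI, h]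
  simp only [mul_entry, map_sum, map_mul, F.ev_gi, F.ev_RL]

theorem stRiem_space_space_time (p j l : Fin n) :
    stRiem F.G T τ (some p) (some j) none (some l) (q.1.1, t) =
      ∑ m, ginv (F.G q.1.2) l m q.1.1 * -tensorP (F.G q.1.2) p j m q.1.1 := by
  have h := F.alg.curv_space_space_time p j l
  rw [F.stRiem_eq q hq hJ hJI]
  -- The summand with `m = 0` drops out because `Γ̃_{ab}^0 = 0`.
  simp only [Fintype.sum_option, stD, stGamma, zero_mul, sub_zero, zero_add]
  rw [h]
  simp only [map_neg, map_sum, map_mul, F.ev_gi, F.ev_P, mul_neg, Finset.sum_neg_distrib]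

theorem stRiem_space_time_space (p k l : Fin n) :
    stRiem F.G T τ (some p) none (some k) (some l) (q.1.1, t) =
      ∑ m, ginv (F.G q.1.2) l m q.1.1 * tensorP (F.G q.1.2) k m p q.1.1 := by
  have h := F.alg.curv_space_time_space F.dTime_comm F.dTime_g p k l
  rw [F.stRiem_eq q hq hJ hJI]
  simp only [Fintype.sum_option, stD, stGamma, zero_mul, sub_zero, zero_add]
  rw [h]
  simp only [map_sum, map_mul, F.ev_gi, F.ev_P]

theorem stRiem_space_time_time (p l : Fin n) :
    stRiem F.G T τ (some p) none none (some l) (q.1.1, t) =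
      ∑ m, ginv (F.G q.1.2) l m q.1.1 * tensorM (F.G q.1.2) p m q.1.1 := by
  have h := F.alg.curv_space_time_time F.dTime_comm F.dTime_g p l
  rw [F.stRiem_eq q hq hJ hJI]
  simp only [Fintype.sum_option, stD, stGamma, zero_mul, sub_zero, zero_add]
  rw [h]
  simp only [map_sum, map_mul, F.ev_gi, F.ev_M]

/-- The curvature operator of space-time in terms of the tensors `M`, `P` and `R_{ijkl}`. -/
theorem stCurvCoord_eq (α β : Option (Fin n) → Option (Fin n) → ℝ)
    (hβ : ∀ i j, β (some i) (some j) = -β (some j) (some i)) :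
    stCurvCoord F.G T τ (q.1.1, t) α β =
      ∑ i, ∑ j, tensorM (F.G q.1.2) i j q.1.1
        * raise₁ (F.G q.1.2) q.1.1 (fun a => α (some a) none) i
        * raise₁ (F.G q.1.2) q.1.1 (fun a => β (some a) none) j
      - ∑ i, ∑ j, ∑ k, tensorP (F.G q.1.2) i j k q.1.1
        * raise₂ (F.G q.1.2) q.1.1 (fun a b => β (some a) (some b)) i j
        * raise₁ (F.G q.1.2) q.1.1 (fun a => α (some a) none) k
      - ∑ i, ∑ j, ∑ k, tensorP (F.G q.1.2) i j k q.1.1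
        * raise₂ (F.G q.1.2) q.1.1 (fun a b => α (some a) (some b)) i j
        * raise₁ (F.G q.1.2) q.1.1 (fun a => β (some a) none) k
      + ∑ i, ∑ j, ∑ k, ∑ l, riemLow (F.G q.1.2) i j k l q.1.1
        * raise₂ (F.G q.1.2) q.1.1 (fun a b => α (some a) (some b)) i j
        * raise₂ (F.G q.1.2) q.1.1 (fun a b => β (some a) (some b)) l k := by
  have hg : ∀ i j, ginv (F.G q.1.2) i j q.1.1 = ginv (F.G q.1.2) j i q.1.1 := fun i j => by
    rw [F.ev_gi, F.ev_gi, F.alg.gi_apply_symm]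
  have r1 : ∀ (W : Fin n → ℝ) p, ∑ i, ginv (F.G q.1.2) i p q.1.1 * W i =
      raise₁ (F.G q.1.2) q.1.1 W p := fun W p => by
    simp only [raise₁, hg p]
  have r2 : ∀ (U : Fin n → Fin n → ℝ) p j, raise₁ (F.G q.1.2) q.1.1
      (fun i => ∑ a, ginv (F.G q.1.2) j a q.1.1 * U i a) p =
        raise₂ (F.G q.1.2) q.1.1 U p j := fun U p j => by
    simp only [raise₁, raise₂, Finset.mul_sum, mul_assoc]
  have r3 : ∀ m k, raise₂ (F.G q.1.2) q.1.1 (fun a b => β (some a) (some b)) m k =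
      -raise₂ (F.G q.1.2) q.1.1 (fun a b => β (some a) (some b)) k m := fun m k => by
    simp only [raise₂]
    rw [Finset.sum_comm, ← Finset.sum_neg_distrib]
    refine Finset.sum_congr rfl fun a _ => ?_
    rw [← Finset.sum_neg_distrib]
    refine Finset.sum_congr rfl fun b _ => ?_
    rw [hβ b a]
    ring
  have hup : ∀ i l j k, stRiemUp F.G T τ (some i) (some l) j k (q.1.1, t) =
      ∑ p, ginv (F.G q.1.2) i p q.1.1 *
        stRiem F.G T τ (some p) j k (some l) (q.1.1, t) := fun i l j k => by
    simp only [stRiemUp, Fintype.sum_option, stMetric, zero_mul, zero_add, ← hq]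
  have hm : ∀ (α : Option (Fin n) → Option (Fin n) → ℝ) i j,
      mixed F.G τ (q.1.1, t) α (some i) (some j) =
        ∑ a, ginv (F.G q.1.2) j a q.1.1 * α (some i) (some a) := fun α i j => by
    simp only [mixed, stMetric, ← hq]
  rw [stCurvCoord, sum_option_split]
  · simp only [hup, hm, show ∀ α i, mixed F.G τ (q.1.1, t) α (some i) none = α (some i) none from
      fun _ _ => rfl, F.stRiem_space q hq hJ hJI, F.stRiem_space_space_time q hq hJ hJI,
      F.stRiem_space_time_space q hq hJ hJI, F.stRiem_space_time_time q hq hJ hJI]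
    have t1 := sum_raise_raise (fun i j => ginv (F.G q.1.2) i j q.1.1)
    simp only [t1]
    simp only [r1, r2 (fun a b => α (some a) (some b)), r2 (fun a b => β (some a) (some b))]
    rw [sub_eq_add_neg, sub_eq_add_neg]
    congr 1
    · congr 1
      · congr 1
        rw [← Finset.sum_neg_distrib]
        refine Finset.sum_congr rfl fun i _ => ?_
        rw [Finset.sum_comm, ← Finset.sum_neg_distrib]
        refine Finset.sum_congr rfl fun j _ => ?_
        rw [← Finset.sum_neg_distrib]
        refine Finset.sum_congr rfl fun k _ => ?_
        -- In this block the raised indices of `β` come in the order opposite to those of `P`;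
        -- antisymmetry supplies the minus sign.
        rw [r3 i j]
        ring
      · rw [Finset.sum_comm]
        simp only [neg_mul, Finset.sum_neg_distrib]
    · calc _ = _ := Finset.sum_congr rfl fun j _ => Finset.sum_comm
        _ = _ := Finset.sum_comm
  · intro j k l
    simp [mixed]
  · intro i j k
    simp [mixed]

end Components

end CoordFlow

namespace CoordFlow

variable {n : ℕ} (F : CoordFlow n) {T : EReal} {τ t : ℝ}

theorem stCurvCoord_symm (q : F.S) (hq : q.1.2 = t + τ)
    (hJ : UniqueDiffWithinAt ℝ (shiftedInterval T τ) t)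
    (hJI : ∀ s ∈ shiftedInterval T τ, s + τ ∈ F.I) (α β : Option (Fin n) → Option (Fin n) → ℝ)
    (hα : ∀ i j, α (some i) (some j) = -α (some j) (some i))
    (hβ : ∀ i j, β (some i) (some j) = -β (some j) (some i)) :
    stCurvCoord F.G T τ (q.1.1, t) α β = stCurvCoord F.G T τ (q.1.1, t) β α := by
  rw [F.stCurvCoord_eq q hq hJ hJI α β hβ, F.stCurvCoord_eq q hq hJ hJI β α hα, sub_right_comm]
  congr 1
  · congr 2
    rw [Finset.sum_comm]
    refine Finset.sum_congr rfl fun i _ => Finset.sum_congr rfl fun j _ => ?_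
    rw [F.ev_M, F.ev_M, F.alg.M_symm]
    ring
  · rw [sum_pair_comm]
    calc _ = _ := Finset.sum_congr rfl fun k _ => Finset.sum_congr rfl fun l _ => Finset.sum_comm
      _ = _ := Finset.sum_comm
    refine Finset.sum_congr rfl fun l _ => Finset.sum_congr rfl fun k _ =>
      Finset.sum_congr rfl fun j _ => Finset.sum_congr rfl fun i _ => ?_
    have h : F.alg.RL i j l k = F.alg.RL l k i j := by
      rw [F.alg.RL_pair, F.alg.RL_antisymm_apply, F.alg.RL_skew_apply, neg_neg]
    rw [F.ev_RL, F.ev_RL, h]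
    ring

theorem stCurvCoord_self (q : F.S) (hq : q.1.2 = t + τ)
    (hJ : UniqueDiffWithinAt ℝ (shiftedInterval T τ) t)
    (hJI : ∀ s ∈ shiftedInterval T τ, s + τ ∈ F.I) (α : Option (Fin n) → Option (Fin n) → ℝ)
    (hα : ∀ i j, α (some i) (some j) = -α (some j) (some i)) :
    stCurvCoord F.G T τ (q.1.1, t) α α = harnackCoord (F.G q.1.2) q.1.1
      (fun a b => α (some a) (some b)) (fun a => α (some a) none) := by
  rw [F.stCurvCoord_eq q hq hJ hJI α α hα, harnackCoord]
  ring

end CoordFlow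

/-! ### The time intervals. -/

theorem timeInterval_convex (T : EReal) : Convex ℝ (timeInterval T) := by
  refine Set.OrdConnected.convex ⟨fun a ha b hb s hs => ⟨ha.1.trans hs.1, ?_⟩⟩
  exact (EReal.coe_le_coe_iff.2 hs.2).trans_lt hb.2

theorem shiftedInterval_convex (T : EReal) (τ : ℝ) : Convex ℝ (shiftedInterval T τ) := by
  refine Set.OrdConnected.convex ⟨fun a ha b hb s hs => ⟨ha.1.trans hs.1, ?_⟩⟩
  exact (EReal.coe_le_coe_iff.2 (add_le_add_left hs.2 τ)).trans_lt hb.2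

/-- The strict upper bound leaves room to the right of any point, also when `T` is infinite. -/
theorem shiftedInterval_nonempty_interior {T : EReal} {τ t : ℝ} (ht : t ∈ shiftedInterval T τ) :
    (interior (shiftedInterval T τ)).Nonempty := by
  obtain ⟨r, hr, hrT⟩ := EReal.lt_iff_exists_real_btwn.1 ht.2
  have hr' : t < r - τ := by
    have := EReal.coe_lt_coe_iff.1 hr
    linarith
  have hsub : Set.Ioo t (r - τ) ⊆ shiftedInterval T τ := fun s hs =>
    ⟨ht.1.trans hs.1.le, (EReal.coe_lt_coe_iff.2 (by linarith [hs.2])).trans hrT⟩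
  exact (Set.nonempty_Ioo.2 hr').mono (interior_maximal hsub isOpen_Ioo)

theorem timeInterval_eq_shiftedInterval (T : EReal) : timeInterval T = shiftedInterval T 0 := by
  simp [timeInterval, shiftedInterval]

theorem add_mem_timeInterval {T : EReal} {τ s : ℝ} (hτ : 0 ≤ τ) (hs : s ∈ shiftedInterval T τ) :
    s + τ ∈ timeInterval T := ⟨add_nonneg hs.1 hτ, hs.2⟩

/-! ### The metric matrix in a chart. -/

section OnManifold

variable {n : ℕ} {M : Type*} [TopologicalSpace M] [ChartedSpace (Model n) M]

/-- By the chain rule the derivative of the chart is a left inverse. -/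
theorem mfderiv_symm_injective {φ : OpenPartialHomeomorph M (Model n)}
    (hφ : φ ∈ IsManifold.maximalAtlas (𝓡 n) ∞ M) {y : Model n} (hy : y ∈ φ.target) :
    Function.Injective (mfderiv (𝓡 n) (𝓡 n) φ.symm y) := by
  have h1 : MDifferentiableAt (𝓡 n) (𝓡 n) φ.symm y :=
    ((contMDiffOn_symm_of_mem_maximalAtlas hφ).contMDiffAt
      (φ.open_target.mem_nhds hy)).mdifferentiableAt (by simp)
  have h2 : MDifferentiableAt (𝓡 n) (𝓡 n) φ (φ.symm y) :=
    (contMDiffAt_of_mem_maximalAtlas hφ (φ.map_target hy)).mdifferentiableAt (by simp)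
  have h3 : HasMFDerivAt (𝓡 n) (𝓡 n) id y _ :=
    (h2.hasMFDerivAt.comp y h1.hasMFDerivAt).congr_of_eventuallyEq (by
      filter_upwards [φ.open_target.mem_nhds hy] with z hz
      exact (φ.right_inv hz).symm)
  have h4 := hasMFDerivAt_unique h3 (hasMFDerivAt_id y)
  intro v w hvw
  have := congrArg (mfderiv (𝓡 n) (𝓡 n) φ (φ.symm y)) hvw
  have h5 : ∀ v, mfderiv (𝓡 n) (𝓡 n) φ (φ.symm y) (mfderiv (𝓡 n) (𝓡 n) φ.symm y v) = v :=
    fun v => congrArg (fun L => L v) h4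
  rwa [h5, h5] at this

variable [IsManifold (𝓡 n) ∞ M]

theorem metricCoord_symm (g : Metric n M) (φ : OpenPartialHomeomorph M (Model n)) (y : Model n) :
    (metricCoord g φ y)ᵀ = metricCoord g φ y := by
  ext i j
  exact g.symm _ _ _

theorem metricCoord_det_ne_zero (g : Metric n M) {φ : OpenPartialHomeomorph M (Model n)}
    (hφ : φ ∈ IsManifold.maximalAtlas (𝓡 n) ∞ M) {y : Model n} (hy : y ∈ φ.target) :
    (metricCoord g φ y).det ≠ 0 := by
  intro hdet
  obtain ⟨v, hv, hv0⟩ := Matrix.exists_mulVec_eq_zero_iff.2 hdet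
  have hz : φ (φ.symm y) ∈ φ.target := φ.map_source (φ.map_target hy)
  -- A kernel vector of the matrix would give a nonzero tangent vector of length zero. `L` stands
  -- for the derivative at `φ (φ.symm y)`, the base point in `coordVec`, so that no transport
  -- between tangent spaces is needed.
  have key : ∀ L : Model n →L[ℝ] TangentSpace (𝓡 n) (φ.symm y), Function.Injective L →
      (∀ i, coordVec φ (φ.symm y) i = L (EuclideanSpace.single i 1)) → False := by
    intro L hL hLc
    have hGv : ∀ i, ∑ j, g.inner (φ.symm y) (L (EuclideanSpace.single i 1))
        (L (EuclideanSpace.single j 1)) * v j = 0 := fun i => by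
      simpa only [mulVec, dotProduct, metricCoord, of_apply, hLc, Pi.zero_apply] using
        congrFun hv0 i
    have hV : ∑ j, v j • (EuclideanSpace.single j (1 : ℝ) : Model n) ≠ 0 := fun h => hv <| by
      funext i
      simpa [WithLp.ofLp_sum, Finset.sum_apply, Pi.single_apply] using
        congrArg (fun w : Model n => w i) h
    refine (g.pos (φ.symm y) (L (∑ j, v j • EuclideanSpace.single j (1 : ℝ)))
      fun h => hV (hL (h.trans (map_zero L).symm))).ne' ?_
    simp only [map_sum, map_smul, _root_.sum_apply, _root_.smul_apply, smul_eq_mul]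
    refine Finset.sum_eq_zero fun i _ => mul_eq_zero_of_right _ ?_
    rw [← hGv i]
    exact Finset.sum_congr rfl fun j _ => by rw [g.symm, mul_comm]
  exact key (mfderiv (𝓡 n) (𝓡 n) φ.symm (φ (φ.symm y))) (mfderiv_symm_injective hφ hz)
    fun i => rfl

/-- A Ricci flow in a chart. -/
def IsRicciFlow.coordFlow {g : ℝ → Metric n M} {T : EReal} (hg : IsRicciFlow g T)
    (hT : (interior (timeInterval T)).Nonempty) {φ : OpenPartialHomeomorph M (Model n)}
    (hφ : φ ∈ IsManifold.maximalAtlas (𝓡 n) ∞ M) : CoordFlow n where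
  Ω := φ.target
  I := timeInterval T
  G s := metricCoord (g s) φ
  isOpen := φ.open_target
  convex := timeInterval_convex T
  nonempty_interior := hT
  smooth := hg.smooth φ hφ
  symm y _ t _ := metricCoord_symm (g t) φ y
  det_ne_zero _ hy t _ := metricCoord_det_ne_zero (g t) hφ hy
  flow := hg.flow φ hφ

end OnManifold

theorem alternating_swap {V : Type*} [AddCommGroup V] [Module ℝ V] (α : V [⋀^Fin 2]→ₗ[ℝ] ℝ)
    (v w : V) : α ![v, w] = -α ![w, v] := by
  rw [← α.map_swap ![w, v] (show (0 : Fin 2) ≠ 1 by decide)]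
  congr 1
  ext i
  fin_cases i <;> simp

end HarnackFlow

end

/-! ### The theorem on the manifold. -/

theorem corollary2p3 {n : ℕ} {M : Type*} [TopologicalSpace M]
    [ChartedSpace (HarnackFlow.Model n) M] [IsManifold (𝓡 n) ∞ M]
    (g : ℝ → HarnackFlow.Metric n M) (T : EReal) (hg : HarnackFlow.IsRicciFlow g T)
    (τ : ℝ) (hτ : 0 ≤ τ) (t : ℝ) (ht : t ∈ HarnackFlow.shiftedInterval T τ)
    (φ : OpenPartialHomeomorph M (HarnackFlow.Model n))
    (hφ : φ ∈ IsManifold.maximalAtlas (𝓡 n) ∞ M) (x : M) (hx : x ∈ φ.source) :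
    (∀ α β : (TangentSpace (𝓡 n) x × ℝ) [⋀^Fin 2]→ₗ[ℝ] ℝ,
      HarnackFlow.stCurv g T τ φ x t α β = HarnackFlow.stCurv g T τ φ x t β α) ∧
    ∀ (U : TangentSpace (𝓡 n) x [⋀^Fin 2]→ₗ[ℝ] ℝ) (W : TangentSpace (𝓡 n) x →ₗ[ℝ] ℝ),
      HarnackFlow.stCurv g T τ φ x t (HarnackFlow.splitTwoForm.symm (U, W))
          (HarnackFlow.splitTwoForm.symm (U, W)) =
        HarnackFlow.harnack (g (t + τ)) φ x U W := by
  open HarnackFlow in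
  have htτ := add_mem_timeInterval hτ ht
  have hT : (interior (timeInterval T)).Nonempty := by
    rw [timeInterval_eq_shiftedInterval] at htτ ⊢
    exact shiftedInterval_nonempty_interior htτ
  have hJ := uniqueDiffOn_convex (shiftedInterval_convex T τ)
    (shiftedInterval_nonempty_interior ht) t ht
  have hJI : ∀ s ∈ shiftedInterval T τ, s + τ ∈ timeInterval T := fun s hs =>
    add_mem_timeInterval hτ hs
  let F := hg.coordFlow hT hφ
  let q : F.S := ⟨(φ x, t + τ), φ.map_source hx, htτ⟩
  refine ⟨fun α β => F.stCurvCoord_symm q rfl hJ hJI _ _ (fun i j => alternating_swap _ _ _)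
    (fun i j => alternating_swap _ _ _), fun U W => ?_⟩
  refine (F.stCurvCoord_self q rfl hJ hJI _ (fun i j => alternating_swap _ _ _)).trans ?_
  have h1 : ∀ i j, splitTwoForm.symm (U, W) ![stCoordVec φ x (some i), stCoordVec φ x (some j)] =
      U ![coordVec φ x i, coordVec φ x j] := fun i j => by
    change U (fun k => (![stCoordVec φ x (some i), stCoordVec φ x (some j)] k).1)
      + (W _ * 0 - W _ * 0) = _
    rw [mul_zero, mul_zero, sub_zero, add_zero]
    congr 1
    funext k
    fin_cases k <;> rfl
  -- The pullback of `U` vanishes here because `∂/∂t` projects to zero on `M`; only `W ∧ dt`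
  -- remains.
  have h2 : ∀ i, splitTwoForm.symm (U, W) ![stCoordVec φ x (some i), stCoordVec φ x none] =
      W (coordVec φ x i) := fun i => by
    change U (fun k => (![stCoordVec φ x (some i), stCoordVec φ x none] k).1)
      + (W (coordVec φ x i) * 1 - W 0 * 0) = _
    rw [mul_one, mul_zero, sub_zero, add_eq_right]
    exact U.map_coord_zero (1 : Fin 2) rfl
  simp only [h1, h2]
  rfl
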